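/- Let $\mathbb D$ be the open unit disk with normalized area measure $dA=\frac1\pi r\,dr\,d\theta$, let $L^2_h$ be the closed subspace of $L^2(\mathbb D,dA)$ consisting of the complex-valued harmonic functions, and let $Q$ be the orthogonal projection of $L^2(\mathbb D,dA)$ onto $L^2_h$. For a bounded measurable function $f$ on $\mathbb D$ let $T_f:L^2_h\to L^2_h$, $T_f u=Q(fu)$, be the Toeplitz operator with symbol $f$. Functions that agree almost everywhere are identified. For a bounded radial function $\phi$ on $\mathbb D$ and an integer $p$, $e^{ip\theta}\phi$ denotes the function $re^{i\theta}\mapsto e^{ip\theta}\phi(r)$. Let $p,s$ be positive integers and let $\phi$ be a non-constant bounded radial function. Then a bounded radial function $\psi$ such that $T_{e^{is\theta}\psi}$ commutes with $T_{e^{ip\theta}\phi}$ is unique up to a multiplicative constant: if $\psi_1,\psi_2$ are bounded radial functions such that both $T_{e^{is\theta}\psi_1}$ and $T_{e^{is\theta}\psi_2}$ commute with $T_{e^{ip\theta}\phi}$, and $\psi_2\neq 0$, then $\psi_1=c\,\psi_2$ for some constant $c\in\mathbb C$. -/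

import Mathlib

open MeasureTheory Metric InnerProductSpace Filter Topology
open scoped ENNReal ComplexConjugate

/-- Normalized area measure `dA = r dr dθ / π` on the open unit disk. -/
noncomputable def diskMeasure : Measure ℂ :=
  ENNReal.ofReal Real.pi⁻¹ • (volume.restrict (ball (0 : ℂ) 1))

instance : IsFiniteMeasure (diskMeasure) := by
  unfold diskMeasure
  have : IsFiniteMeasure (volume.restrict (ball (0 : ℂ) 1)) :=
    ⟨by rw [Measure.restrict_apply_univ]; exact measure_ball_lt_top⟩
  exact Measure.smul_finite _ ENNReal.ofReal_ne_top

theorem diskMeasure_ae_mem : ∀ᵐ z ∂diskMeasure, z ∈ ball (0 : ℂ) 1 :=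
  Measure.ae_smul_measure (ae_restrict_mem measurableSet_ball) _

/-- The open annulus `a < |z| < b`. -/
def annulus (a b : ℝ) : Set ℂ := {z | a < ‖z‖ ∧ ‖z‖ < b}

theorem measurableSet_annulus (a b : ℝ) : MeasurableSet (annulus a b) :=
  (measurableSet_lt measurable_const measurable_norm).inter
    (measurableSet_lt measurable_norm measurable_const)

theorem circleAverage_poisson {h : ℂ → ℂ} (hh : HarmonicOnNhd h (ball 0 1))
    {r : ℝ} (hr1 : r < 1) {w : ℂ} (hw : ‖w‖ < r) :
    Real.circleAverage (fun z => ((herglotzRieszKernel 0 w z).re : ℂ) * h z) 0 r = h w := by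
  have hr0 : 0 < r := (norm_nonneg w).trans_lt hw
  have hsub : closedBall (0 : ℂ) r ⊆ ball 0 1 := closedBall_subset_ball hr1
  have hc : ContinuousOn h (sphere 0 |r|) := by
    have := hh.contDiffOn.continuousOn
    refine this.mono ?_
    rw [abs_of_pos hr0]
    exact sphere_subset_closedBall.trans hsub
  have hk : ContinuousOn (fun z => ((herglotzRieszKernel 0 w z).re : ℂ)) (sphere 0 |r|) := by
    rw [herglotzRieszKernel_fun_def]
    have : ∀ z ∈ sphere (0 : ℂ) |r|, z - 0 - (w - 0) ≠ 0 := by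
      intro z hz h0
      rw [abs_of_pos hr0, mem_sphere_zero_iff_norm] at hz
      have : z = w := by simpa [sub_eq_zero] using h0
      subst this
      linarith
    fun_prop (disch := assumption)
  have hi : CircleIntegrable (fun z => ((herglotzRieszKernel 0 w z).re : ℂ) * h z) 0 r :=
    (hk.mul hc).circleIntegrable'
  apply Complex.ext
  · have h1 := HarmonicOnNhd.circleAverage_re_herglotzRieszKernel_smul
      ((hh.comp_CLM Complex.reCLM).mono hsub) (w := w) (by simpa using hw)
    rw [← Complex.reCLM_apply, ← Complex.reCLM.circleAverage_comp_comm hi]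
    rw [← Complex.reCLM_apply, ← Function.comp_apply (f := Complex.reCLM) (g := h), ← h1]
    congr 1
    ext z
    simp
  · have h1 := HarmonicOnNhd.circleAverage_re_herglotzRieszKernel_smul
      ((hh.comp_CLM Complex.imCLM).mono hsub) (w := w) (by simpa using hw)
    rw [← Complex.imCLM_apply, ← Complex.imCLM.circleAverage_comp_comm hi]
    rw [← Complex.imCLM_apply, ← Function.comp_apply (f := Complex.imCLM) (g := h), ← h1]
    congr 1
    ext z
    simp

theorem setIntegral_annulus {F : ℂ → ℂ} {a b : ℝ} (ha : 0 < a)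
    (hF : ContinuousOn F {z | a ≤ ‖z‖ ∧ ‖z‖ ≤ b}) :
    ∫ z in annulus a b, F z =
      ∫ r in Set.Ioo a b, (r * (2 * Real.pi)) • Real.circleAverage F 0 r := by
  have hsymm : ∀ p : ℝ × ℝ, Complex.polarCoord.symm p = circleMap 0 p.1 p.2 := by
    intro p
    rw [Complex.polarCoord_symm_apply, circleMap, Complex.exp_mul_I]
    simp
  rw [← integral_indicator (measurableSet_annulus a b), ← Complex.integral_comp_polarCoord_symm]
  have hpt : polarCoord.target = Set.Ioi (0 : ℝ) ×ˢ Set.Ioo (-Real.pi) Real.pi := rfl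
  have hms : MeasurableSet polarCoord.target := polarCoord.open_target.measurableSet
  have e1 : ∫ p in polarCoord.target,
      p.1 • (annulus a b).indicator F (Complex.polarCoord.symm p) =
      ∫ p in Set.Ioo a b ×ˢ Set.Ioo (-Real.pi) Real.pi, p.1 • F (circleMap 0 p.1 p.2) := by
    rw [← integral_indicator hms,
      ← integral_indicator (measurableSet_Ioo.prod measurableSet_Ioo)]
    congr 1
    ext p
    by_cases hp : p ∈ Set.Ioo a b ×ˢ Set.Ioo (-Real.pi) Real.pi
    · have hp0 : 0 < p.1 := ha.trans hp.1.1
      rw [Set.indicator_of_mem hp, Set.indicator_of_mem (by rw [hpt]; exact ⟨hp0, hp.2⟩),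
        Set.indicator_of_mem, hsymm]
      rw [hsymm]
      simpa [annulus, abs_of_pos hp0] using hp.1
    · rw [Set.indicator_of_notMem hp]
      by_cases hq : p ∈ polarCoord.target
      · rw [Set.indicator_of_mem hq, Set.indicator_of_notMem, smul_zero]
        rw [hsymm]
        intro hm
        rw [hpt] at hq
        have hq0 : 0 < p.1 := hq.1
        apply hp
        refine ⟨?_, hq.2⟩
        simpa [annulus, abs_of_pos hq0] using hm
      · rw [Set.indicator_of_notMem hq]
  have hcont : ContinuousOn (fun p : ℝ × ℝ => p.1 • F (circleMap 0 p.1 p.2))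
      (Set.Icc a b ×ˢ Set.Icc (-Real.pi) Real.pi) := by
    have hcm : Continuous (fun p : ℝ × ℝ => circleMap 0 p.1 p.2) := by
      unfold circleMap; fun_prop
    refine continuousOn_fst.smul (hF.comp hcm.continuousOn ?_)
    intro p hp
    have hp0 : 0 < p.1 := ha.trans_le hp.1.1
    simpa [abs_of_pos hp0] using hp.1
  have hint : IntegrableOn (fun p : ℝ × ℝ => p.1 • F (circleMap 0 p.1 p.2))
      (Set.Ioo a b ×ˢ Set.Ioo (-Real.pi) Real.pi) (volume.prod volume) :=
    (hcont.integrableOn_compact (isCompact_Icc.prod isCompact_Icc)).mono_set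
      (Set.prod_mono Set.Ioo_subset_Icc_self Set.Ioo_subset_Icc_self)
  rw [e1, Measure.volume_eq_prod, setIntegral_prod _ hint]
  refine setIntegral_congr_fun measurableSet_Ioo fun r hr => ?_
  simp only
  rw [integral_smul, Real.circleAverage_eq_integral_add (-Real.pi),
    intervalIntegral.integral_comp_add_right (fun θ => F (circleMap 0 r θ)), smul_smul,
    ← integral_Ioc_eq_integral_Ioo, ← intervalIntegral.integral_of_le (by linarith [Real.pi_pos])]
  have : 2 * Real.pi + -Real.pi = Real.pi := by ring
  rw [this, zero_add]
  congr 1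
  have := Real.pi_pos
  field_simp

theorem setIntegral_poisson {h : ℂ → ℂ} (hh : HarmonicOnNhd h (ball 0 1))
    {a b : ℝ} (ha : 0 < a) (hab : a < b) (hb : b < 1) {w : ℂ} (hw : ‖w‖ < a) :
    ∫ z in annulus a b, ((herglotzRieszKernel 0 w z).re : ℂ) * h z =
      (Real.pi * (b ^ 2 - a ^ 2) : ℝ) • h w := by
  have hc : ContinuousOn h {z | a ≤ ‖z‖ ∧ ‖z‖ ≤ b} := by
    refine hh.contDiffOn.continuousOn.mono fun z hz => ?_
    have := hz.2
    simp; linarith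
  have hk : ContinuousOn (fun z => ((herglotzRieszKernel 0 w z).re : ℂ))
      {z | a ≤ ‖z‖ ∧ ‖z‖ ≤ b} := by
    rw [herglotzRieszKernel_fun_def]
    have : ∀ z ∈ {z : ℂ | a ≤ ‖z‖ ∧ ‖z‖ ≤ b}, z - 0 - (w - 0) ≠ 0 := by
      intro z hz h0
      have : z = w := by simpa [sub_eq_zero] using h0
      subst this
      have := hz.1
      linarith
    fun_prop (disch := assumption)
  have hkc : ContinuousOn (fun z => ((herglotzRieszKernel 0 w z).re : ℂ) * h z)
      {z | a ≤ ‖z‖ ∧ ‖z‖ ≤ b} := hk.mul hc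
  rw [setIntegral_annulus ha hkc]
  have : ∀ r ∈ Set.Ioo a b, (r * (2 * Real.pi)) • Real.circleAverage
      (fun z => ((herglotzRieszKernel 0 w z).re : ℂ) * h z) 0 r = (r * (2 * Real.pi)) • h w := by
    intro r hr
    rw [circleAverage_poisson hh (hr.2.trans hb) (hw.trans hr.1)]
  rw [setIntegral_congr_fun measurableSet_Ioo this, integral_smul_const,
    ← integral_Ioc_eq_integral_Ioo, ← intervalIntegral.integral_of_le hab.le,
    intervalIntegral.integral_mul_const, integral_id]
  congr 1
  ring

theorem norm_herglotz_le {a b : ℝ} {w z : ℂ} (hw : ‖w‖ < a) (hz : z ∈ annulus a b) :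
    ‖herglotzRieszKernel 0 w z‖ ≤ 2 * b / (a - ‖w‖) := by
  have h1 := norm_sub_norm_le z w
  have h2 := norm_add_le z w
  have h3 := hz.1
  have h4 := hz.2
  have h5 : 0 < a - ‖w‖ := by linarith
  have h6 : a - ‖w‖ ≤ ‖z - w‖ := by linarith
  have h7 : ‖z + w‖ ≤ 2 * b := by linarith
  rw [herglotzRieszKernel_def, norm_div]
  simp only [sub_zero]
  have h8 : 0 ≤ 2 * b := (norm_nonneg _).trans h7
  gcongr

theorem measurable_herglotz (w : ℂ) : Measurable fun z => herglotzRieszKernel 0 w z := by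
  rw [herglotzRieszKernel_fun_def]
  fun_prop

theorem integrableOn_herglotz {g : ℂ → ℂ} {a b : ℝ}
    (hg : IntegrableOn g (annulus a b) diskMeasure) {w : ℂ} (hw : ‖w‖ < a) :
    IntegrableOn (fun z => herglotzRieszKernel 0 w z * g z) (annulus a b) diskMeasure :=
  Integrable.bdd_mul (c := 2 * b / (a - ‖w‖)) hg (measurable_herglotz w).aestronglyMeasurable
    ((ae_restrict_iff' (measurableSet_annulus a b)).2
      (Eventually.of_forall fun _ hz => norm_herglotz_le hw hz))

theorem differentiableOn_herglotz {g : ℂ → ℂ} {a b : ℝ}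
    (hg : IntegrableOn g (annulus a b) diskMeasure) :
    DifferentiableOn ℂ (fun w => ∫ z in annulus a b, herglotzRieszKernel 0 w z * g z ∂diskMeasure)
      (ball 0 a) := by
  intro w₀ hw₀
  rw [mem_ball_zero_iff] at hw₀
  set c := (‖w₀‖ + a) / 2 with hc
  have hca : c < a := by linarith
  have hc0 : 0 < c := by linarith [norm_nonneg w₀]
  have hnhds : ball (0 : ℂ) c ∈ 𝓝 w₀ := isOpen_ball.mem_nhds (by simp; linarith)
  have hbd : ∀ z ∈ annulus a b, ∀ w ∈ ball (0 : ℂ) c, a - c ≤ ‖z - w‖ := by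
    intro z hz w hw
    have h1 := norm_sub_norm_le z w
    have h2 := hz.1
    rw [mem_ball_zero_iff] at hw
    linarith
  have hne : ∀ z ∈ annulus a b, ∀ w ∈ ball (0 : ℂ) c, z - w ≠ 0 := by
    intro z hz w hw h0
    have := hbd z hz w hw
    rw [h0, norm_zero] at this
    linarith
  have hmeas := hg.aestronglyMeasurable
  have key := hasDerivAt_integral_of_dominated_loc_of_deriv_le
    (μ := diskMeasure.restrict (annulus a b))
    (F := fun w z => herglotzRieszKernel 0 w z * g z)
    (F' := fun w z => 2 * z / (z - w) ^ 2 * g z)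
    (bound := fun z => 2 * b / (a - c) ^ 2 * ‖g z‖)
    (x₀ := w₀) hnhds
    (Eventually.of_forall fun w => (measurable_herglotz w).aestronglyMeasurable.mul hmeas)
    ?_ ?_ ?_ ?_ ?_
  · exact key.2.differentiableAt.differentiableWithinAt
  · exact integrableOn_herglotz hg hw₀
  · exact (by fun_prop : Measurable fun z : ℂ => 2 * z / (z - w₀) ^ 2).aestronglyMeasurable.mul
      hmeas
  · refine (ae_restrict_iff' (measurableSet_annulus a b)).2
      (Eventually.of_forall fun z hz w hw => ?_)
    have h1 := hbd z hz w hw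
    have := hz.1
    have := hz.2
    have : 0 < a - c := by linarith
    rw [norm_mul, norm_div, norm_mul, norm_pow]
    simp only [Complex.norm_ofNat]
    have hb0 : ‖z‖ ≤ b := hz.2.le
    have : 0 ≤ b := (norm_nonneg z).trans hb0
    gcongr
  · exact hg.norm.const_mul _
  · refine (ae_restrict_iff' (measurableSet_annulus a b)).2
      (Eventually.of_forall fun z hz w hw => ?_)
    have h0 := hne z hz w hw
    refine HasDerivAt.mul_const ?_ (g z)
    have h1 : HasDerivAt (fun w => (z + w) / (z - w))
        ((1 * (z - w) - (z + w) * (-1)) / (z - w) ^ 2) w :=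
      HasDerivAt.div ((hasDerivAt_id w).const_add z) ((hasDerivAt_id w).const_sub z) h0
    simp only [herglotzRieszKernel_def, sub_zero]
    have h2 : 2 * z / (z - w) ^ 2 = (1 * (z - w) - (z + w) * (-1)) / (z - w) ^ 2 := by ring
    rw [h2]
    exact h1

theorem harmonicOnNhd_poissonIntegral {g : ℂ → ℂ} {a b : ℝ}
    (hg : IntegrableOn g (annulus a b) diskMeasure) :
    HarmonicOnNhd
      (fun w => ∫ z in annulus a b, ((herglotzRieszKernel 0 w z).re : ℂ) * g z ∂diskMeasure)
      (ball 0 a) := by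
  have hg' : IntegrableOn (fun z => conj (g z)) (annulus a b) diskMeasure :=
    Complex.conjCLE.toContinuousLinearMap.integrable_comp hg
  have d1 := differentiableOn_herglotz hg
  have d2 := differentiableOn_herglotz hg'
  intro w hw
  have a1 := (d1.analyticAt (isOpen_ball.mem_nhds hw)).harmonicAt
  have a2 := (d2.analyticAt (isOpen_ball.mem_nhds hw)).harmonicAt_conj
  refine (harmonicAt_congr_nhds ?_).1 ((a1.add a2).const_smul (c := (1 / 2 : ℝ)))
  filter_upwards [isOpen_ball.mem_nhds hw] with v hv
  simp only [Pi.smul_apply, Pi.add_apply, Pi.conj_apply]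
  rw [← integral_conj, ← integral_add (integrableOn_herglotz hg (mem_ball_zero_iff.1 hv)), ← integral_smul]
  · congr 1
    ext z
    simp only [map_mul, Complex.conj_conj, Complex.real_smul]
    rw [← add_mul, Complex.add_conj]
    push_cast
    ring
  · exact Complex.conjCLE.toContinuousLinearMap.integrable_comp 
      (integrableOn_herglotz hg' (mem_ball_zero_iff.1 hv))

theorem setIntegral_poisson_disk {h : ℂ → ℂ} (hh : HarmonicOnNhd h (ball 0 1))
    {a b : ℝ} (ha : 0 < a) (hab : a < b) (hb : b < 1) {w : ℂ} (hw : ‖w‖ < a) :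
    ∫ z in annulus a b, ((herglotzRieszKernel 0 w z).re : ℂ) * h z ∂diskMeasure =
      (b ^ 2 - a ^ 2 : ℝ) • h w := by
  have hsub : annulus a b ⊆ ball 0 1 := fun z hz => by
    have := hz.2
    simp; linarith
  rw [diskMeasure, Measure.restrict_smul, Measure.restrict_restrict_of_subset hsub,
    integral_smul_measure, setIntegral_poisson hh ha hab hb hw,
    ENNReal.toReal_ofReal (by positivity), smul_smul, ← mul_assoc,
    inv_mul_cancel₀ Real.pi_ne_zero, one_mul]

/-- The harmonic Bergman space `L²_h`: the subspace of `L²(𝔻, dA)` of (classes of) complex-valued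
harmonic functions on the open unit disk. -/
noncomputable def harmonicBergman : Submodule ℂ (Lp ℂ 2 diskMeasure) where
  carrier := {u | ∃ h : ℂ → ℂ, HarmonicOnNhd h (ball 0 1) ∧ u =ᵐ[diskMeasure] h}
  add_mem' := by
    rintro u v ⟨h, hh, hu⟩ ⟨k, hk, hv⟩
    exact ⟨h + k, hh.add hk, (Lp.coeFn_add u v).trans (hu.add hv)⟩
  zero_mem' := ⟨0, fun z _ => analyticAt_const.harmonicAt, Lp.coeFn_zero ℂ 2 diskMeasure⟩
  smul_mem' := by
    rintro c u ⟨h, hh, hu⟩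
    refine ⟨c • h, fun z hz => ?_, (Lp.coeFn_smul c u).trans (hu.const_smul c)⟩
    exact (hh z hz).comp_CLM ((ContinuousLinearMap.mul ℂ ℂ c).restrictScalars ℝ)

theorem tendsto_setIntegral_annulus {u : ℕ → Lp ℂ 2 diskMeasure} {v : Lp ℂ 2 diskMeasure}
    (huv : Tendsto u atTop (𝓝 v)) {a b : ℝ} {w : ℂ} (hw : ‖w‖ < a) :
    Tendsto
      (fun n => ∫ z in annulus a b, ((herglotzRieszKernel 0 w z).re : ℂ) * u n z ∂diskMeasure)
      atTop
      (𝓝 (∫ z in annulus a b, ((herglotzRieszKernel 0 w z).re : ℂ) * v z ∂diskMeasure)) := by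
  have hm := measurableSet_annulus a b
  set f : ℂ → ℂ := (annulus a b).indicator fun z => ((herglotzRieszKernel 0 w z).re : ℂ) with hf
  have hfm : MemLp f 2 diskMeasure := by
    refine MemLp.of_bound (C := max (2 * b / (a - ‖w‖)) 0) ?_ (Eventually.of_forall fun z => ?_)
    · exact ((Complex.measurable_ofReal.comp
        (Complex.measurable_re.comp (measurable_herglotz w))).indicator hm).aestronglyMeasurable
    · by_cases hz : z ∈ annulus a b
      · rw [hf, Set.indicator_of_mem hz, Complex.norm_real]
        exact ((Complex.abs_re_le_norm _).trans (norm_herglotz_le hw hz)).trans (le_max_left _ _)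
      · rw [hf, Set.indicator_of_notMem hz, norm_zero]
        exact le_max_right _ _
  have key : ∀ g : Lp ℂ 2 diskMeasure, inner ℂ (hfm.toLp f) g =
      ∫ z in annulus a b, ((herglotzRieszKernel 0 w z).re : ℂ) * g z ∂diskMeasure := by
    intro g
    rw [L2.inner_def, ← integral_indicator hm]
    refine integral_congr_ae ?_
    filter_upwards [hfm.coeFn_toLp] with z hz
    rw [hz, hf]
    by_cases hz : z ∈ annulus a b
    · simp [Set.indicator_of_mem hz, mul_comm]
    · simp [Set.indicator_of_notMem hz]
  simp only [← key]
  exact tendsto_const_nhds.inner huv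

theorem isClosed_harmonicBergman : IsClosed (harmonicBergman : Set (Lp ℂ 2 diskMeasure)) := by
  refine IsSeqClosed.isClosed ?_
  intro u v hu huv
  choose h hh huh using hu
  have hint : ∀ a b : ℝ, IntegrableOn (v : ℂ → ℂ) (annulus a b) diskMeasure := fun a b =>
    ((Lp.memLp v).integrable (by norm_num)).integrableOn
  -- pointwise convergence of the harmonic representatives
  have hlim : ∀ a b : ℝ, 0 < a → a < b → b < 1 → ∀ w : ℂ, ‖w‖ < a →
      Tendsto (fun n => h n w) atTop (𝓝 ((b ^ 2 - a ^ 2 : ℝ)⁻¹ •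
        ∫ z in annulus a b, ((herglotzRieszKernel 0 w z).re : ℂ) * v z ∂diskMeasure)) := by
    intro a b ha hab hb w hw
    have h0 : (b ^ 2 - a ^ 2 : ℝ) ≠ 0 := by nlinarith
    refine ((tendsto_setIntegral_annulus huv (b := b) hw).const_smul
      (b ^ 2 - a ^ 2 : ℝ)⁻¹).congr fun n => ?_
    rw [← inv_smul_smul₀ h0 (h n w), ← setIntegral_poisson_disk (hh n) ha hab hb hw]
    congr 1
    refine integral_congr_ae (ae_restrict_of_ae ?_)
    filter_upwards [huh n] with z hz
    rw [hz]
  have hH : ∀ a b : ℝ, 0 < a → a < b → b < 1 → ∀ w : ℂ, ‖w‖ < a →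
      limUnder atTop (fun n => h n w) = (b ^ 2 - a ^ 2 : ℝ)⁻¹ •
        ∫ z in annulus a b, ((herglotzRieszKernel 0 w z).re : ℂ) * v z ∂diskMeasure :=
    fun a b ha hab hb w hw => (hlim a b ha hab hb w hw).limUnder_eq
  have hex : ∀ w ∈ ball (0 : ℂ) 1, ∃ a b : ℝ, 0 < a ∧ a < b ∧ b < 1 ∧ ‖w‖ < a := by
    intro w hw
    rw [mem_ball_zero_iff] at hw
    obtain ⟨a, h1, h2⟩ := exists_between hw
    obtain ⟨b, h3, h4⟩ := exists_between h2
    exact ⟨a, b, (norm_nonneg w).trans_lt h1, h3, h4, h1⟩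
  refine ⟨fun w => limUnder atTop fun n => h n w, fun w hw => ?_, ?_⟩
  · obtain ⟨a, b, ha, hab, hb, hwa⟩ := hex w hw
    have hP := (harmonicOnNhd_poissonIntegral (hint a b) w
      (mem_ball_zero_iff.2 hwa)).const_smul (c := (b ^ 2 - a ^ 2 : ℝ)⁻¹)
    refine (harmonicAt_congr_nhds ?_).1 hP
    filter_upwards [isOpen_ball.mem_nhds (mem_ball_zero_iff.2 hwa)] with z hz
    exact (hH a b ha hab hb z (mem_ball_zero_iff.1 hz)).symm
  · obtain ⟨ns, hns, hae⟩ := (tendstoInMeasure_of_tendsto_Lp huv).exists_seq_tendsto_ae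
    filter_upwards [hae, ae_all_iff.2 huh, diskMeasure_ae_mem] with z h1 h2 h3
    obtain ⟨a, b, ha, hab, hb, hza⟩ := hex z h3
    simp only [h2] at h1
    rw [hH a b ha hab hb z hza]
    exact tendsto_nhds_unique h1 ((hlim a b ha hab hb z hza).comp hns.tendsto_atTop)

instance : CompleteSpace harmonicBergman :=
  isClosed_harmonicBergman.completeSpace_coe

/-- The Toeplitz operator `T_f u = Q (f u)` on `L²_h` with bounded symbol `f`, where `Q` is the
orthogonal projection of `L²(𝔻, dA)` onto `L²_h`; `holderL` of the multiplication of `ℂ` is the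
pointwise product `L^∞ × L² → L²`. -/
noncomputable def toeplitz (f : ℂ → ℂ) (hf : MemLp f ∞ diskMeasure) :
    harmonicBergman →L[ℂ] harmonicBergman :=
  harmonicBergman.orthogonalProjectionOnto ∘L
    (((ContinuousLinearMap.mul ℂ ℂ).holderL diskMeasure ∞ 2 2 (hf.toLp f)) ∘L
      harmonicBergman.subtypeL)

/-- The quasihomogeneous function `r e^{iθ} ↦ e^{ipθ} φ(r)` of order `p`; the radial function `φ` is
given as a function of `r = |z|`, and only its values on `(0, 1)` matter. -/
noncomputable def quasihomogeneous (p : ℤ) (φ : ℝ → ℂ) (z : ℂ) : ℂ :=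
  Complex.exp (Complex.I * p * Complex.arg z) * φ ‖z‖

theorem quasiMeasurePreserving_norm_disk :
    Measure.QuasiMeasurePreserving (fun z : ℂ => ‖z‖) diskMeasure
      (volume.restrict (Set.Ioo (0 : ℝ) 1)) := by
  refine ⟨measurable_norm, Measure.AbsolutelyContinuous.mk fun s hs hs0 => ?_⟩
  rw [Measure.restrict_apply hs] at hs0
  rw [Measure.map_apply measurable_norm hs, diskMeasure, Measure.smul_apply,
    Measure.restrict_apply (measurable_norm hs), smul_eq_mul, mul_eq_zero]
  right
  have hm : MeasurableSet ((fun z : ℂ => ‖z‖) ⁻¹' s ∩ ball 0 1) :=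
    (measurable_norm hs).inter measurableSet_ball
  have hm2 : MeasurableSet ((s ∩ Set.Ioo (0 : ℝ) 1) ×ˢ (Set.univ : Set ℝ)) :=
    (hs.inter measurableSet_Ioo).prod .univ
  rw [← lintegral_indicator_one hm, ← Complex.lintegral_comp_polarCoord_symm]
  refine lintegral_eq_zero_of_ae_eq_zero ?_
  have hnull : volume ((s ∩ Set.Ioo (0 : ℝ) 1) ×ˢ (Set.univ : Set ℝ)) = 0 := by
    rw [Measure.volume_eq_prod, Measure.prod_prod, hs0, zero_mul]
  filter_upwards [ae_restrict_mem polarCoord.open_target.measurableSet,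
    ae_restrict_of_ae (measure_eq_zero_iff_ae_notMem.1 hnull)] with p hp hps
  have hp0 : 0 < p.1 := hp.1
  rw [Set.indicator_of_notMem]
  · simp
  · rintro ⟨h1, h2⟩
    simp only [Set.mem_preimage, mem_ball_zero_iff, Complex.norm_polarCoord_symm,
      abs_of_pos hp0] at h1 h2
    exact hps ⟨⟨h1, hp0, h2⟩, trivial⟩

theorem memLp_quasihomogeneous (p : ℤ) {φ : ℝ → ℂ}
    (hφ : MemLp φ ∞ (volume.restrict (Set.Ioo (0 : ℝ) 1))) :
    MemLp (quasihomogeneous p φ) ∞ diskMeasure := by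
  have h1 : AEStronglyMeasurable (fun z : ℂ => φ ‖z‖) diskMeasure :=
    hφ.1.comp_quasiMeasurePreserving quasiMeasurePreserving_norm_disk
  have h2 : Measurable fun z : ℂ => Complex.exp (Complex.I * p * Complex.arg z) := by
    fun_prop
  refine memLp_top_of_bound (h2.aestronglyMeasurable.mul h1)
    (eLpNormEssSup φ (volume.restrict (Set.Ioo (0 : ℝ) 1))).toReal ?_
  have h3 := quasiMeasurePreserving_norm_disk.ae
    (enorm_ae_le_eLpNormEssSup φ (volume.restrict (Set.Ioo (0 : ℝ) 1)))
  filter_upwards [h3] with z hz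
  have h4 : eLpNormEssSup φ (volume.restrict (Set.Ioo (0 : ℝ) 1)) ≠ ∞ := by
    have := hφ.2
    rw [eLpNorm_exponent_top] at this
    exact this.ne
  have h5 : ‖Complex.exp (Complex.I * p * Complex.arg z)‖ = 1 := by
    rw [show Complex.I * (p : ℂ) * Complex.arg z = ((p * Complex.arg z : ℝ) : ℂ) * Complex.I by
      push_cast; ring]
    exact Complex.norm_exp_ofReal_mul_I _
  rw [quasihomogeneous, norm_mul, h5, one_mul, ← toReal_enorm]
  exact ENNReal.toReal_mono h4 hz

/-!
Both sides of the commutation relation map a monomial `z ^ n` with `n` large to a multiple of a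
monomial. Comparing the coefficients gives an identity between the moments of `φ` and of `ψ`;
eliminating `φ` from the identities for `ψ₁` and `ψ₂` shows that the quotient of the moments of `ψ₁`
and `ψ₂` is invariant under translation by `2p` on an arithmetic progression. The moments are
bounded holomorphic functions on the right half-plane, and such a function vanishes identically as
soon as it vanishes on an arithmetic progression, since its zeros violate the Blaschke condition.
Hence the quotient has period `2p` on the half-plane, is constant for the same reason, and
`ψ₁ - c ψ₂` has vanishing moments.
-/

/-- The open right half-plane, on which the moments of radial functions are holomorphic. -/
def rightHalfPlane : Set ℂ := {z | 0 < z.re}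

theorem isOpen_rightHalfPlane : IsOpen rightHalfPlane :=
  isOpen_lt continuous_const Complex.continuous_re

theorem isPreconnected_rightHalfPlane : IsPreconnected rightHalfPlane :=
  (convex_halfSpace_re_gt 0).isPreconnected

theorem add_ne_zero_of_mem_rightHalfPlane {z w : ℂ} (hz : z ∈ rightHalfPlane)
    (hw : w ∈ rightHalfPlane) : z + w ≠ 0 := by
  intro h
  have hre : z.re + w.re = 0 := by rw [← Complex.add_re, h, Complex.zero_re]
  exact (add_pos hz hw).ne' hre

theorem add_mem_rightHalfPlane {z a : ℂ} (hz : z ∈ rightHalfPlane) (ha : 0 ≤ a.re) :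
    z + a ∈ rightHalfPlane :=
  add_pos_of_pos_of_nonneg hz ha

theorem ofReal_mem_rightHalfPlane {x : ℝ} : (x : ℂ) ∈ rightHalfPlane ↔ 0 < x := Iff.rfl

theorem cayley_mem_rightHalfPlane {a : ℝ} (ha : 0 < a) {w : ℂ} (hw : w ∈ ball (0 : ℂ) 1) :
    a * ((1 + w) / (1 - w)) ∈ rightHalfPlane := by
  have hw1 : Complex.normSq w < 1 := by
    rw [Complex.normSq_eq_norm_sq]
    exact pow_lt_one₀ (norm_nonneg w) (mem_ball_zero_iff.1 hw) two_ne_zero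
  have h0 : 0 < Complex.normSq (1 - w) := by
    refine Complex.normSq_pos.2 (sub_ne_zero.2 ?_)
    rintro rfl
    simp at hw1
  have hre : (a * ((1 + w) / (1 - w))).re =
      a * ((1 - Complex.normSq w) / Complex.normSq (1 - w)) := by
    rw [Complex.re_ofReal_mul, Complex.div_re, ← add_div]
    congr 2
    simp [Complex.normSq_apply]
    ring
  exact lt_of_lt_of_eq (mul_pos ha (div_pos (by linarith) h0)) hre.symm

theorem norm_sub_ofReal_lt_norm_add_ofReal {a : ℝ} (ha : 0 < a) {z : ℂ}
    (hz : z ∈ rightHalfPlane) : ‖z - a‖ < ‖z + a‖ := by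
  have hz' : 0 < z.re := hz
  refine lt_of_pow_lt_pow_left₀ 2 (norm_nonneg _) ?_
  rw [← Complex.normSq_eq_norm_sq, ← Complex.normSq_eq_norm_sq, Complex.normSq_sub,
    Complex.normSq_add, Complex.conj_ofReal, Complex.re_mul_ofReal]
  nlinarith [mul_pos hz' ha]

theorem norm_mul_norm_add_le_of_apply_eq_zero {f : ℂ → ℂ} {a C : ℝ} (ha : 0 < a)
    (hf : DifferentiableOn ℂ f rightHalfPlane) (hC : ∀ z ∈ rightHalfPlane, ‖f z‖ ≤ C)
    (h0 : f a = 0) {z : ℂ} (hz : z ∈ rightHalfPlane) : ‖f z‖ * ‖z + a‖ ≤ C * ‖z - a‖ := by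
  have hza := add_ne_zero_of_mem_rightHalfPlane hz (ofReal_mem_rightHalfPlane.2 ha)
  have ha0 : (a : ℂ) ≠ 0 := Complex.ofReal_ne_zero.2 ha.ne'
  set w := (z - a) / (z + a) with hw
  have hwball : w ∈ ball (0 : ℂ) 1 := by
    rw [mem_ball_zero_iff, norm_div, div_lt_one (norm_pos_iff.2 hza)]
    exact norm_sub_ofReal_lt_norm_add_ofReal ha hz
  have hcayley : (a : ℂ) * ((1 + w) / (1 - w)) = z := by
    have h1 : 1 + w = 2 * z / (z + a) := by rw [hw]; field_simp; ring
    have h2 : 1 - w = 2 * a / (z + a) := by rw [hw]; field_simp; ring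
    rw [h1, h2]
    field_simp
  have hd : DifferentiableOn ℂ (fun w => f (a * ((1 + w) / (1 - w)))) (ball 0 1) := by
    refine hf.comp (fun w hw => ?_) fun w hw => cayley_mem_rightHalfPlane ha hw
    have hw1 : 1 - w ≠ 0 := sub_ne_zero.2 (by rintro rfl; simp at hw)
    exact DifferentiableAt.differentiableWithinAt (by fun_prop (disch := assumption))
  have hschwarz := Complex.dist_le_div_mul_dist_of_mapsTo_ball (R₂ := C) hd
    (fun w hw => by simpa [h0] using hC _ (cayley_mem_rightHalfPlane ha hw)) hwball
  rw [hcayley, add_zero, sub_zero, div_one, mul_one, h0, dist_zero_right, dist_zero_right, div_one,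
    hw, norm_div, mul_div_assoc', le_div_iff₀ (norm_pos_iff.2 hza)] at hschwarz
  exact hschwarz

/-- Division by the Blaschke factor `(z - a) / (z + a)`, with the denominator cleared so that the
identity also holds at `z = a` and `z = -a`. -/
theorem exists_mul_add_eq_sub_mul {f : ℂ → ℂ} {a C : ℝ} (ha : 0 < a)
    (hf : DifferentiableOn ℂ f rightHalfPlane) (hC : ∀ z ∈ rightHalfPlane, ‖f z‖ ≤ C)
    (h0 : f a = 0) :
    ∃ g : ℂ → ℂ, DifferentiableOn ℂ g rightHalfPlane ∧ (∀ z ∈ rightHalfPlane, ‖g z‖ ≤ C) ∧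
      ∀ z, f z * (z + a) = (z - a) * g z := by
  have hmem := isOpen_rightHalfPlane.mem_nhds (ofReal_mem_rightHalfPlane.2 ha)
  have hg : DifferentiableOn ℂ (fun z => dslope f a z * (z + a)) rightHalfPlane :=
    ((Complex.differentiableOn_dslope hmem).2 hf).mul (by fun_prop)
  have heq : ∀ z, f z * (z + a) = (z - a) * (dslope f a z * (z + a)) := fun z => by
    rw [← mul_assoc, ← smul_eq_mul (z - a), sub_smul_dslope, h0, sub_zero]
  have hne : ∀ z ∈ rightHalfPlane, z ≠ a → ‖dslope f a z * (z + a)‖ ≤ C := fun z hz hza => by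
    have h := norm_mul_norm_add_le_of_apply_eq_zero ha hf hC h0 hz
    rw [← norm_mul, heq, norm_mul, mul_comm] at h
    exact le_of_mul_le_mul_right h (norm_pos_iff.2 (sub_ne_zero.2 hza))
  refine ⟨_, hg, fun z hz => ?_, heq⟩
  rcases eq_or_ne z a with rfl | hza
  · have hcont := ((hg.differentiableAt hmem).continuousAt.norm.tendsto.mono_left
      nhdsWithin_le_nhds : Tendsto _ (𝓝[≠] (a : ℂ)) _)
    refine le_of_tendsto hcont ?_
    filter_upwards [self_mem_nhdsWithin, mem_nhdsWithin_of_mem_nhds hmem] with w hwa hw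
    exact hne w hw hwa
  · exact hne z hz hza

theorem norm_mul_prod_le_of_apply_eq_zero {C : ℝ} {z : ℂ} (hz : z ∈ rightHalfPlane) (n : ℕ) :
    ∀ {f : ℂ → ℂ} {a : ℕ → ℝ}, (∀ k, 0 < a k) → Function.Injective a →
      DifferentiableOn ℂ f rightHalfPlane → (∀ w ∈ rightHalfPlane, ‖f w‖ ≤ C) →
      (∀ k, f (a k) = 0) →
      ‖f z‖ ≤ C * ∏ k ∈ Finset.range n, ‖(z - a k) / (z + a k)‖ := by
  induction n with
  | zero => intro f a _ _ _ hC _; simpa using hC z hz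
  | succ n ih =>
    intro f a ha hinj hf hC h0
    obtain ⟨g, hg, hgC, hfg⟩ := exists_mul_add_eq_sub_mul (ha 0) hf hC (h0 0)
    have hg0 : ∀ k, g (a (k + 1)) = 0 := fun k => by
      have h := hfg (a (k + 1))
      rw [h0, zero_mul, ← Complex.ofReal_sub] at h
      refine (mul_eq_zero.1 h.symm).resolve_left (Complex.ofReal_ne_zero.2 (sub_ne_zero.2 ?_))
      exact hinj.ne (Nat.succ_ne_zero k)
    have hza := add_ne_zero_of_mem_rightHalfPlane hz (ofReal_mem_rightHalfPlane.2 (ha 0))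
    have hfz : f z = g z * ((z - a 0) / (z + a 0)) := by
      rw [mul_div_assoc', eq_div_iff hza, hfg, mul_comm]
    rw [Finset.prod_range_succ', ← mul_assoc, hfz, norm_mul]
    gcongr
    exact ih (fun k => ha (k + 1)) (hinj.comp (add_left_injective 1)) hg hgC hg0

theorem norm_sub_div_add_le_exp {x a : ℝ} (hx : 0 < x) (hxa : x ≤ a) :
    ‖((x : ℂ) - a) / (x + a)‖ ≤ Real.exp (-(x * a⁻¹)) := by
  have ha : 0 < a := hx.trans_le hxa
  rw [← Complex.ofReal_sub, ← Complex.ofReal_add, ← Complex.ofReal_div, Complex.norm_real,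
    Real.norm_eq_abs, abs_div, abs_of_nonpos (sub_nonpos.2 hxa), abs_of_pos (add_pos hx ha)]
  refine le_trans ?_ (Real.one_sub_le_exp_neg (x * a⁻¹))
  rw [div_le_iff₀ (by positivity)]
  field_simp
  nlinarith

theorem eqOn_zero_of_not_summable_inv {f : ℂ → ℂ} {a : ℕ → ℝ} {C : ℝ} (ha : StrictMono a)
    (ha0 : 0 < a 0) (hsum : ¬ Summable fun k => (a k)⁻¹)
    (hf : DifferentiableOn ℂ f rightHalfPlane) (hC : ∀ z ∈ rightHalfPlane, ‖f z‖ ≤ C)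
    (h0 : ∀ k, f (a k) = 0) : Set.EqOn f 0 rightHalfPlane := by
  have hapos : ∀ k, 0 < a k := fun k => ha0.trans_le (ha.monotone k.zero_le)
  have hzero : ∀ x ∈ Set.Ioo 0 (a 0), f (x : ℂ) = 0 := by
    intro x hx
    have hbound : ∀ n, ‖f x‖ ≤ C * Real.exp (-(x * ∑ k ∈ Finset.range n, (a k)⁻¹)) := fun n => by
      have hC0 : 0 ≤ C := (norm_nonneg _).trans (hC x hx.1)
      refine (norm_mul_prod_le_of_apply_eq_zero hx.1 n hapos ha.injective hf hC h0).trans ?_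
      rw [Finset.mul_sum, ← Finset.sum_neg_distrib, Real.exp_sum]
      gcongr with k
      exact norm_sub_div_add_le_exp hx.1 (hx.2.le.trans (ha.monotone k.zero_le))
    have hlim := (not_summable_iff_tendsto_nat_atTop_of_nonneg
      fun k => (inv_pos.2 (hapos k)).le).1 hsum
    have hexp := (Real.tendsto_exp_neg_atTop_nhds_zero.comp
      (hlim.const_mul_atTop hx.1)).const_mul C
    rw [mul_zero] at hexp
    exact norm_le_zero_iff.1 (ge_of_tendsto' hexp hbound)
  have hhalf : a 0 / 2 ∈ Set.Ioo 0 (a 0) := ⟨half_pos ha0, half_lt_self ha0⟩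
  refine (hf.analyticOnNhd isOpen_rightHalfPlane).eqOn_zero_of_preconnected_of_frequently_eq_zero
    isPreconnected_rightHalfPlane (ofReal_mem_rightHalfPlane.2 hhalf.1) ?_
  have htend : Tendsto (fun x : ℝ => (x : ℂ)) (𝓝[≠] (a 0 / 2)) (𝓝[≠] ((a 0 / 2 : ℝ) : ℂ)) :=
    Complex.continuous_ofReal.continuousWithinAt.tendsto_nhdsWithin
      fun _ hx h => hx (Complex.ofReal_injective h)
  refine htend.frequently (Eventually.frequently ?_)
  filter_upwards [mem_nhdsWithin_of_mem_nhds (isOpen_Ioo.mem_nhds hhalf)] with x hx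
  exact hzero x hx

/-- The algebra `H^∞` of bounded holomorphic functions on the right half-plane; the values outside
the half-plane are arbitrary, so its elements are compared there by `Set.EqOn`. -/
def boundedHolomorphic : Subalgebra ℂ (ℂ → ℂ) where
  carrier := {f | DifferentiableOn ℂ f rightHalfPlane ∧ ∃ C, ∀ z ∈ rightHalfPlane, ‖f z‖ ≤ C}
  mul_mem' := by
    rintro f g ⟨hf, C, hC⟩ ⟨hg, D, hD⟩
    refine ⟨hf.mul hg, C * D, fun z hz => ?_⟩
    rw [Pi.mul_apply, norm_mul]
    exact mul_le_mul (hC z hz) (hD z hz) (norm_nonneg _) ((norm_nonneg _).trans (hC z hz))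
  add_mem' := by
    rintro f g ⟨hf, C, hC⟩ ⟨hg, D, hD⟩
    exact ⟨hf.add hg, C + D, fun z hz => norm_add_le_of_le (hC z hz) (hD z hz)⟩
  algebraMap_mem' := fun c => ⟨differentiableOn_const c, ‖c‖, fun _ _ => le_rfl⟩

namespace boundedHolomorphic

variable {F G : ℂ → ℂ}

theorem comp_add_const_mem (hF : F ∈ boundedHolomorphic) {a : ℂ} (ha : 0 ≤ a.re) :
    (fun z => F (z + a)) ∈ boundedHolomorphic := by
  obtain ⟨hd, C, hC⟩ := hF
  exact ⟨hd.comp (by fun_prop) fun z hz => add_mem_rightHalfPlane hz ha, C,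
    fun z hz => hC _ (add_mem_rightHalfPlane hz ha)⟩

theorem eqOn_zero_of_arithmetic_progression (hF : F ∈ boundedHolomorphic) {a d : ℝ} (ha : 0 < a)
    (hd : 0 < d) (h : ∀ k : ℕ, F (a + d * k : ℝ) = 0) : Set.EqOn F 0 rightHalfPlane := by
  obtain ⟨hF, C, hC⟩ := hF
  have hmono : StrictMono fun k : ℕ => a + d * k :=
    (Nat.strictMono_cast.const_mul hd).const_add a
  have hsum : ¬ Summable fun k : ℕ => (a + d * k)⁻¹ := by
    intro hs
    refine lt_irrefl (1 : ℝ) ((Real.summable_one_div_nat_add_rpow (a / d) 1).1 ?_)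
    refine (hs.mul_left d).congr fun k => ?_
    rw [Real.rpow_one, abs_of_pos (by positivity)]
    field_simp
    ring
  exact eqOn_zero_of_not_summable_inv hmono (by simpa using ha) hsum hF hC h

theorem eqOn_zero_or_eqOn_zero (hF : F ∈ boundedHolomorphic) (hG : G ∈ boundedHolomorphic)
    (h : Set.EqOn (F * G) 0 rightHalfPlane) :
    Set.EqOn F 0 rightHalfPlane ∨ Set.EqOn G 0 rightHalfPlane :=
  (hF.1.analyticOnNhd isOpen_rightHalfPlane).eq_zero_or_eq_zero_of_mul_eq_zero
    (hG.1.analyticOnNhd isOpen_rightHalfPlane) h isPreconnected_rightHalfPlane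

theorem eqOn_zero_of_comp_add_const (hF : F ∈ boundedHolomorphic) {a : ℝ} (ha : 0 ≤ a)
    (h : Set.EqOn (fun z => F (z + a)) 0 rightHalfPlane) : Set.EqOn F 0 rightHalfPlane := by
  refine eqOn_zero_of_arithmetic_progression hF (add_pos_of_pos_of_nonneg one_pos ha) one_pos
    fun k => ?_
  have hk : F (((1 + k : ℝ) : ℂ) + a) = 0 :=
    h (ofReal_mem_rightHalfPlane.2 (add_pos_of_pos_of_nonneg one_pos k.cast_nonneg))
  rw [← hk, ← Complex.ofReal_add]
  ring_nf

theorem apply_add_mul_eq_of_div_periodic (hF : F ∈ boundedHolomorphic) (hG : G ∈ boundedHolomorphic)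
    (hG0 : ¬ Set.EqOn G 0 rightHalfPlane) {d : ℝ} (hd : 0 ≤ d)
    (h : ∀ z ∈ rightHalfPlane, F (z + d) * G z = G (z + d) * F z) (k : ℕ) :
    ∀ z ∈ rightHalfPlane, F (z + (d * k : ℝ)) * G z = G (z + (d * k : ℝ)) * F z := by
  induction k with
  | zero => intro z _; simp [mul_comm]
  | succ k ih =>
    have hshift : ∀ {E : ℂ → ℂ}, E ∈ boundedHolomorphic → ∀ j : ℕ,
        (fun z => E (z + (d * j : ℝ))) ∈ boundedHolomorphic := fun hE j =>
      comp_add_const_mem hE (by rw [Complex.ofReal_re]; positivity)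
    have hmul : ∀ z ∈ rightHalfPlane, G (z + (d * k : ℝ)) *
        (F (z + (d * (k + 1 : ℕ) : ℝ)) * G z - G (z + (d * (k + 1 : ℕ) : ℝ)) * F z) = 0 := by
      intro z hz
      have hstep := h (z + (d * k : ℝ))
        (add_mem_rightHalfPlane hz (by rw [Complex.ofReal_re]; positivity))
      have hsucc : z + (d * (k + 1 : ℕ) : ℝ) = z + (d * k : ℝ) + d := by push_cast; ring
      rw [hsucc]
      linear_combination G z * hstep + G (z + (d * k : ℝ) + d) * ih z hz
    have hdiff := (eqOn_zero_or_eqOn_zero (hshift hG k)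
      (sub_mem (mul_mem (hshift hF (k + 1)) hG) (mul_mem (hshift hG (k + 1)) hF))
      hmul).resolve_left fun h0 => hG0 (eqOn_zero_of_comp_add_const hG (by positivity) h0)
    exact fun z hz => sub_eq_zero.1 (hdiff hz)

theorem exists_eqOn_smul_of_div_periodic (hF : F ∈ boundedHolomorphic)
    (hG : G ∈ boundedHolomorphic) (hG0 : ¬ Set.EqOn G 0 rightHalfPlane) {d : ℝ} (hd : 0 < d)
    (h : ∀ z ∈ rightHalfPlane, F (z + d) * G z = G (z + d) * F z) :
    ∃ c : ℂ, Set.EqOn F (c • G) rightHalfPlane := by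
  obtain ⟨x, hx, hGx⟩ : ∃ x : ℝ, 0 < x ∧ G x ≠ 0 := by
    by_contra! hcon
    exact hG0 (eqOn_zero_of_arithmetic_progression hG one_pos one_pos
      fun k => hcon _ (by positivity))
  have hdiff : Set.EqOn (F - (F x / G x) • G) 0 rightHalfPlane := by
    refine eqOn_zero_of_arithmetic_progression
      (sub_mem hF (Subalgebra.smul_mem _ hG _)) hx hd fun k => ?_
    have hk := apply_add_mul_eq_of_div_periodic hF hG hG0 hd.le h k x hx
    rw [← Complex.ofReal_add] at hk
    rw [Pi.sub_apply, Pi.smul_apply, smul_eq_mul, sub_eq_zero, div_mul_eq_mul_div, eq_div_iff hGx,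
      hk, mul_comm]
  exact ⟨F x / G x, fun z hz => sub_eq_zero.1 (hdiff hz)⟩

end boundedHolomorphic

theorem integral_ofReal_mul_eq_zero_of_forall_pow {μ : Measure ℝ} {a b : ℝ}
    (hμ : ∀ᵐ x ∂μ, x ∈ Set.Icc a b) {Φ : ℝ → ℂ} (hΦ : Integrable Φ μ)
    (h0 : ∀ n : ℕ, ∫ x, (x : ℂ) ^ n * Φ x ∂μ = 0) {h : ℝ → ℝ} (hh : Continuous h) :
    ∫ x, (h x : ℂ) * Φ x ∂μ = 0 := by
  have hint : ∀ g : ℝ → ℝ, Continuous g → Integrable (fun x => (g x : ℂ) * Φ x) μ := by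
    intro g hg
    obtain ⟨C, hC⟩ := isCompact_Icc.exists_bound_of_continuousOn
      (hg.continuousOn (s := Set.Icc a b))
    refine hΦ.bdd_mul (c := C) (Complex.continuous_ofReal.comp hg).aestronglyMeasurable ?_
    filter_upwards [hμ] with x hx
    rw [Complex.norm_real]
    exact hC x hx
  have hpoly : ∀ P : Polynomial ℝ, ∫ x, ((P.eval x : ℝ) : ℂ) * Φ x ∂μ = 0 := by
    intro P
    induction P using Polynomial.induction_on' with
    | add P Q hP hQ =>
      simp only [Polynomial.eval_add, Complex.ofReal_add, add_mul]
      rw [integral_add (hint _ P.continuous) (hint _ Q.continuous), hP, hQ, add_zero]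
    | monomial n a =>
      simp only [Polynomial.eval_monomial, Complex.ofReal_mul, Complex.ofReal_pow, mul_assoc]
      rw [integral_const_mul, h0, mul_zero]
  set K := ∫ x, ‖Φ x‖ ∂μ with hKdef
  have : 0 ≤ K := integral_nonneg fun _ => norm_nonneg _
  refine norm_le_zero_iff.1 (le_of_forall_pos_le_add fun ε hε => ?_)
  obtain ⟨P, hP⟩ := exists_polynomial_near_of_continuousOn a b h hh.continuousOn
    (ε / (K + 1)) (by positivity)
  calc ‖∫ x, (h x : ℂ) * Φ x ∂μ‖
      = ‖∫ x, ((h x : ℂ) * Φ x - ((P.eval x : ℝ) : ℂ) * Φ x) ∂μ‖ := by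
        rw [integral_sub (hint _ hh) (hint _ P.continuous), hpoly, sub_zero]
    _ ≤ ∫ x, ε / (K + 1) * ‖Φ x‖ ∂μ := by
        refine norm_integral_le_of_norm_le (hΦ.norm.const_mul _) ?_
        filter_upwards [hμ] with x hx
        rw [← sub_mul, norm_mul, ← Complex.ofReal_sub, Complex.norm_real, norm_sub_rev]
        gcongr
        exact (hP x hx).le
    _ = ε * (K / (K + 1)) := by rw [integral_const_mul, ← hKdef]; ring
    _ ≤ 0 + ε := by
        rw [zero_add]
        exact mul_le_of_le_one_right hε.le ((div_le_one (by positivity)).2 (by linarith))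

theorem ae_eq_zero_of_forall_integral_pow_mul_eq_zero {a b : ℝ} {Φ : ℝ → ℂ}
    (hΦ : IntegrableOn Φ (Set.Ioo a b))
    (h0 : ∀ n : ℕ, ∫ x in Set.Ioo a b, (x : ℂ) ^ n * Φ x = 0) :
    Φ =ᵐ[volume.restrict (Set.Ioo a b)] 0 := by
  have hmem := ae_restrict_mem (μ := (volume : Measure ℝ)) (measurableSet_Ioo (a := a) (b := b))
  have hzero := (isOpen_Ioo (a := a) (b := b)).ae_eq_zero_of_integral_contDiff_smul_eq_zero
    (hΦ.locallyIntegrable.locallyIntegrableOn _) fun g hg _ _ => by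
      simpa using integral_ofReal_mul_eq_zero_of_forall_pow
        (hmem.mono fun _ => (Set.Ioo_subset_Icc_self ·)) hΦ h0 hg.continuous
  filter_upwards [hzero, hmem] with x hx hxmem
  exact hx hxmem

/-- The moments `∫₀¹ r ^ ζ φ(r) dr` of a radial function; up to a shift of `ζ` by `1` this is the
Mellin transform of the extension of `φ` by zero. -/
noncomputable def radialMoment (φ : ℝ → ℂ) (ζ : ℂ) : ℂ :=
  ∫ r in Set.Ioo (0 : ℝ) 1, (r : ℂ) ^ ζ * φ r

section RadialMoment

variable {φ ψ : ℝ → ℂ} {ζ : ℂ}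

theorem norm_cpow_le_one {r : ℝ} (hr : r ∈ Set.Ioo (0 : ℝ) 1) (hζ : 0 ≤ ζ.re) :
    ‖(r : ℂ) ^ ζ‖ ≤ 1 := by
  rw [Complex.norm_cpow_eq_rpow_re_of_pos hr.1]
  exact Real.rpow_le_one hr.1.le hr.2.le hζ

theorem integrableOn_cpow_mul (hφ : IntegrableOn φ (Set.Ioo 0 1)) (hζ : 0 ≤ ζ.re) :
    IntegrableOn (fun r : ℝ => (r : ℂ) ^ ζ * φ r) (Set.Ioo 0 1) :=
  Integrable.bdd_mul (c := 1) hφ (by fun_prop : Measurable _).aestronglyMeasurable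
    ((ae_restrict_mem measurableSet_Ioo).mono fun _ hr => norm_cpow_le_one hr hζ)

theorem norm_radialMoment_le (hφ : IntegrableOn φ (Set.Ioo 0 1)) (hζ : 0 ≤ ζ.re) :
    ‖radialMoment φ ζ‖ ≤ ∫ r in Set.Ioo (0 : ℝ) 1, ‖φ r‖ := by
  refine norm_integral_le_of_norm_le hφ.norm ?_
  filter_upwards [ae_restrict_mem measurableSet_Ioo] with r hr
  rw [norm_mul]
  exact mul_le_of_le_one_left (norm_nonneg _) (norm_cpow_le_one hr hζ)

theorem radialMoment_sub (hφ : IntegrableOn φ (Set.Ioo 0 1)) (hψ : IntegrableOn ψ (Set.Ioo 0 1))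
    (hζ : 0 ≤ ζ.re) : radialMoment (φ - ψ) ζ = radialMoment φ ζ - radialMoment ψ ζ := by
  simp only [radialMoment, Pi.sub_apply, mul_sub]
  exact integral_sub (integrableOn_cpow_mul hφ hζ) (integrableOn_cpow_mul hψ hζ)

theorem radialMoment_smul (c : ℂ) (φ : ℝ → ℂ) (ζ : ℂ) :
    radialMoment (c • φ) ζ = c * radialMoment φ ζ := by
  simp only [radialMoment, Pi.smul_apply, smul_eq_mul, mul_left_comm _ c]
  exact integral_const_mul _ _

theorem radialMoment_cpow_mul (φ : ℝ → ℂ) (ζ η : ℂ) :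
    radialMoment (fun r => (r : ℂ) ^ η * φ r) ζ = radialMoment φ (ζ + η) := by
  refine setIntegral_congr_fun measurableSet_Ioo fun r hr => ?_
  rw [Complex.cpow_add _ _ (Complex.ofReal_ne_zero.2 hr.1.ne'), mul_assoc]

theorem radialMoment_one (hζ : 0 ≤ ζ.re) : radialMoment 1 ζ = 1 / (ζ + 1) := by
  have hζ1 : ζ + 1 ≠ 0 := fun h => by
    have hre : ζ.re + 1 = 0 := congrArg Complex.re h
    linarith
  simp only [radialMoment, Pi.one_apply, mul_one]
  rw [← integral_Ioc_eq_integral_Ioo, ← intervalIntegral.integral_of_le zero_le_one,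
    integral_cpow (Or.inl (by linarith)), Complex.ofReal_one, Complex.one_cpow,
    Complex.ofReal_zero, Complex.zero_cpow hζ1, sub_zero]

theorem norm_cpow_mul_log_le {r δ : ℝ} (hr : r ∈ Set.Ioo (0 : ℝ) 1) (hδ : 0 < δ)
    (hζ : δ ≤ ζ.re) : ‖(r : ℂ) ^ ζ * Complex.log r‖ ≤ 1 / δ := by
  have hlog := Real.abs_log_mul_self_rpow_lt r δ hr.1 hr.2.le hδ
  have hpow : r ^ ζ.re ≤ r ^ δ := Real.rpow_le_rpow_of_exponent_ge hr.1 hr.2.le hζ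
  rw [abs_mul, abs_of_nonneg (Real.rpow_nonneg hr.1.le _), mul_comm] at hlog
  rw [norm_mul, Complex.norm_cpow_eq_rpow_re_of_pos hr.1, ← Complex.ofReal_log hr.1.le,
    Complex.norm_real, Real.norm_eq_abs]
  exact (mul_le_mul_of_nonneg_right hpow (abs_nonneg _)).trans hlog.le

theorem differentiableAt_radialMoment (hφ : IntegrableOn φ (Set.Ioo 0 1)) (hζ : 0 < ζ.re) :
    DifferentiableAt ℂ (radialMoment φ) ζ := by
  have hnhds : {η : ℂ | ζ.re / 2 < η.re} ∈ 𝓝 ζ :=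
    (isOpen_lt continuous_const Complex.continuous_re).mem_nhds (half_lt_self hζ)
  have hmem := ae_restrict_mem (μ := (volume : Measure ℝ)) (measurableSet_Ioo (a := 0) (b := 1))
  refine (hasDerivAt_integral_of_dominated_loc_of_deriv_le
    (F := fun η r => (r : ℂ) ^ η * φ r)
    (F' := fun η r => (r : ℂ) ^ η * Complex.log r * φ r)
    (bound := fun r => 1 / (ζ.re / 2) * ‖φ r‖) hnhds
    (Eventually.of_forall fun η =>
      (by fun_prop : Measurable _).aestronglyMeasurable.mul hφ.aestronglyMeasurable)
    (integrableOn_cpow_mul hφ hζ.le)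
    ((by fun_prop : Measurable fun r : ℝ =>
      (r : ℂ) ^ ζ * Complex.log r).aestronglyMeasurable.mul hφ.aestronglyMeasurable)
    ?_ (hφ.norm.const_mul _) ?_).2.differentiableAt
  · filter_upwards [hmem] with r hr η hη
    rw [norm_mul]
    exact mul_le_mul_of_nonneg_right (norm_cpow_mul_log_le hr (half_pos hζ) (le_of_lt hη))
      (norm_nonneg _)
  · filter_upwards [hmem] with r hr η _
    refine HasDerivAt.mul_const ?_ (φ r)
    simpa using (hasDerivAt_id η).const_cpow (Or.inl (Complex.ofReal_ne_zero.2 hr.1.ne'))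

theorem radialMoment_mem_boundedHolomorphic (hφ : IntegrableOn φ (Set.Ioo 0 1)) :
    radialMoment φ ∈ boundedHolomorphic :=
  ⟨fun _ hζ => (differentiableAt_radialMoment hφ hζ).differentiableWithinAt, _,
    fun _ hζ => norm_radialMoment_le hφ (le_of_lt hζ)⟩

theorem ae_eq_zero_of_eqOn_radialMoment (hφ : IntegrableOn φ (Set.Ioo 0 1))
    (h : Set.EqOn (radialMoment φ) 0 rightHalfPlane) :
    φ =ᵐ[volume.restrict (Set.Ioo (0 : ℝ) 1)] 0 := by
  have hzero := ae_eq_zero_of_forall_integral_pow_mul_eq_zero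
    (integrableOn_cpow_mul hφ (ζ := 1) zero_le_one) fun n => by
      have hn : radialMoment φ (n + 1) = 0 := h <| by
        rw [rightHalfPlane, Set.mem_ofPred_eq, Complex.add_re, Complex.natCast_re, Complex.one_re]
        positivity
      rw [← radialMoment_cpow_mul] at hn
      simpa [radialMoment] using hn
  filter_upwards [hzero, ae_restrict_mem measurableSet_Ioo] with r hr hr01
  simpa [hr01.1.ne'] using hr

end RadialMoment

section CircleAverage

variable {F h : ℂ → ℂ} {r : ℝ}

theorem circleAverage_pow_mul (hF : DiffContOnCl ℂ F (ball 0 |r|)) (k : ℕ) :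
    Real.circleAverage (fun z => z ^ k * F z) 0 r = 0 ^ k * F 0 :=
  DiffContOnCl.circleAverage
    ((Differentiable.diffContOnCl (differentiable_id.pow k)).smul hF)

theorem conj_eq_sq_mul_inv_of_mem_sphere {z : ℂ} (hr : r ≠ 0) (hz : z ∈ sphere (0 : ℂ) |r|) :
    conj z = (r : ℂ) ^ 2 * z⁻¹ := by
  rw [mem_sphere_zero_iff_norm] at hz
  have hz0 : z ≠ 0 := norm_pos_iff.1 (hz ▸ abs_pos.2 hr)
  rw [eq_mul_inv_iff_mul_eq₀ hz0, Complex.conj_mul', hz, ← Complex.ofReal_pow, sq_abs,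
    Complex.ofReal_pow]

theorem circleAverage_conj_pow_mul (hr : 0 < r) (hF : DiffContOnCl ℂ F (ball 0 r)) (k : ℕ) :
    Real.circleAverage (fun z => conj z ^ k * F z) 0 r =
      (r : ℂ) ^ (2 * k) * (iteratedDeriv k F 0 / k.factorial) := by
  have hsphere : Set.EqOn (fun z => conj z ^ k * F z)
      (fun z => (r : ℂ) ^ (2 * k) • ((z ^ k)⁻¹ * F z)) (sphere 0 |r|) := fun z hz => by
    simp only [conj_eq_sq_mul_inv_of_mem_sphere hr.ne' hz, smul_eq_mul, mul_pow, inv_pow, pow_mul,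
      mul_assoc]
  have hcauchy : (∮ z in C(0, r), (z - 0)⁻¹ • ((z ^ k)⁻¹ * F z)) =
      2 * Real.pi * Complex.I / k.factorial * iteratedDeriv k F 0 := by
    rw [← smul_eq_mul (2 * Real.pi * Complex.I / _),
      ← hF.circleIntegral_one_div_sub_center_pow_smul hr]
    simp only [sub_zero, smul_eq_mul, pow_succ', one_div, mul_inv, mul_assoc]
  rw [Real.circleAverage_congr_sphere hsphere, Real.circleAverage_fun_smul,
    Real.circleAverage_eq_circleIntegral hr.ne', hcauchy, smul_eq_mul, smul_eq_mul, mul_div_assoc,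
    mul_assoc, mul_assoc, div_mul_eq_mul_div]
  field_simp [Complex.two_pi_I_ne_zero]

theorem circleAverage_conj {c : ℂ} (hF : CircleIntegrable F c r) :
    Real.circleAverage (fun z => conj (F z)) c r = conj (Real.circleAverage F c r) :=
  Complex.conjCLE.toContinuousLinearMap.circleAverage_comp_comm hF

theorem circleAverage_pow_mul_conj (hr : 0 < r) (hF : DiffContOnCl ℂ F (ball 0 r)) (k : ℕ) :
    Real.circleAverage (fun z => z ^ k * conj (F z)) 0 r =
      (r : ℂ) ^ (2 * k) * conj (iteratedDeriv k F 0 / k.factorial) := by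
  have hcont : ContinuousOn (fun z => conj z ^ k * F z) (sphere 0 |r|) :=
    (Complex.continuous_conj.pow k).continuousOn.mul
      (hF.continuousOn_ball.mono ((abs_of_pos hr).symm ▸ sphere_subset_closedBall))
  have hconj := circleAverage_conj hcont.circleIntegrable'
  simp only [map_mul, map_pow, Complex.conj_conj] at hconj
  rw [hconj, circleAverage_conj_pow_mul hr hF, map_mul, map_pow, Complex.conj_ofReal]

theorem exists_analyticOnNhd_add_conj (hh : HarmonicOnNhd h (ball 0 1)) :
    ∃ G H : ℂ → ℂ, AnalyticOnNhd ℂ G (ball 0 1) ∧ AnalyticOnNhd ℂ H (ball 0 1) ∧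
      Set.EqOn h (fun z => G z + conj (H z)) (ball 0 1) := by
  obtain ⟨F₁, hF₁, h₁⟩ := (hh.comp_CLM Complex.reCLM).exists_analyticOnNhd_ball_re_eq
  obtain ⟨F₂, hF₂, h₂⟩ := (hh.comp_CLM Complex.imCLM).exists_analyticOnNhd_ball_re_eq
  refine ⟨fun z => (F₁ z + Complex.I * F₂ z) / 2, fun z => (F₁ z - Complex.I * F₂ z) / 2,
    fun z hz => ?_, fun z hz => ?_, fun z hz => ?_⟩
  · exact ((hF₁ z hz).add (analyticAt_const.mul (hF₂ z hz))).div analyticAt_const two_ne_zero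
  · exact ((hF₁ z hz).sub (analyticAt_const.mul (hF₂ z hz))).div analyticAt_const two_ne_zero
  · have hre : (F₁ z).re = (h z).re := h₁ hz
    have him : (F₂ z).re = (h z).im := h₂ hz
    apply Complex.ext <;> simp [← hre, ← him, Complex.conj_ofNat] <;> ring

theorem exists_circleAverage_pow_mul_conj (hh : HarmonicOnNhd h (ball 0 1)) (k : ℕ) :
    ∃ C : ℂ, ∀ r ∈ Set.Ioo (0 : ℝ) 1,
      Real.circleAverage (fun z => z ^ k * conj (h z)) 0 r = (r : ℂ) ^ (2 * k) * C := by
  obtain ⟨G, H, hG, hH, hGH⟩ := exists_analyticOnNhd_add_conj hh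
  refine ⟨0 ^ k * H 0 + conj (iteratedDeriv k G 0 / k.factorial), fun r hr => ?_⟩
  have hball : closedBall (0 : ℂ) r ⊆ ball 0 1 := closedBall_subset_ball hr.2
  have hdiff : ∀ {E : ℂ → ℂ}, AnalyticOnNhd ℂ E (ball 0 1) → DiffContOnCl ℂ E (ball 0 r) :=
    fun hE => (hE.differentiableOn.mono
      (closure_ball_subset_closedBall.trans hball)).diffContOnCl
  have hsphere : sphere (0 : ℂ) |r| ⊆ ball 0 1 := by
    rw [abs_of_pos hr.1]
    exact sphere_subset_closedBall.trans hball
  have hcongr : Set.EqOn (fun z => z ^ k * conj (h z))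
      ((fun z => z ^ k * H z) + fun z => z ^ k * conj (G z)) (sphere 0 |r|) := by
    intro z hz
    simp only [hGH (hsphere hz), Pi.add_apply, map_add, Complex.conj_conj, mul_add, add_comm]
  have hcH : ContinuousOn (fun z => z ^ k * H z) (sphere 0 |r|) :=
    (continuous_pow k).continuousOn.mul (hH.continuousOn.mono hsphere)
  have hcG : ContinuousOn (fun z => z ^ k * conj (G z)) (sphere 0 |r|) :=
    (continuous_pow k).continuousOn.mul
      (Complex.continuous_conj.comp_continuousOn (hG.continuousOn.mono hsphere))
  have hpow : (r : ℂ) ^ (2 * k) * (0 ^ k * H 0) = 0 ^ k * H 0 := by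
    rcases k.eq_zero_or_pos with rfl | hk
    · rw [mul_zero, pow_zero, one_mul]
    · rw [zero_pow hk.ne', zero_mul, mul_zero]
  rw [Real.circleAverage_congr_sphere hcongr,
    Real.circleAverage_add hcH.circleIntegrable' hcG.circleIntegrable',
    circleAverage_pow_mul ((abs_of_pos hr.1).symm ▸ hdiff hH),
    circleAverage_pow_mul_conj hr.1 (hdiff hG), mul_add, hpow]

end CircleAverage

theorem measurable_circleMap_zero : Measurable fun q : ℝ × ℝ => circleMap 0 q.1 q.2 := by
  unfold circleMap
  fun_prop

theorem diskMeasure_eq_map_circleMap :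
    diskMeasure = Measure.map (fun q : ℝ × ℝ => circleMap 0 q.1 q.2)
      ((volume.restrict (Set.Ioo (0 : ℝ) 1 ×ˢ Set.Ioo (-Real.pi) Real.pi)).withDensity
        fun q => ENNReal.ofReal (Real.pi⁻¹ * q.1)) := by
  have hsymm : ∀ q : ℝ × ℝ, Complex.polarCoord.symm q = circleMap 0 q.1 q.2 := fun q => by
    rw [Complex.polarCoord_symm_apply, circleMap, Complex.exp_mul_I, zero_add]
    push_cast
    rfl
  refine Measure.ext_of_lintegral _ fun f hf => ?_
  rw [lintegral_map hf measurable_circleMap_zero,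
    lintegral_withDensity_eq_lintegral_mul _ (by fun_prop)
      (show Measurable fun q : ℝ × ℝ => f (circleMap 0 q.1 q.2) from
        hf.comp measurable_circleMap_zero),
    diskMeasure, lintegral_smul_measure, ← lintegral_indicator measurableSet_ball,
    ← Complex.lintegral_comp_polarCoord_symm, smul_eq_mul,
    ← lintegral_const_mul' _ _ ENNReal.ofReal_ne_top,
    ← lintegral_indicator polarCoord.open_target.measurableSet,
    ← lintegral_indicator (measurableSet_Ioo.prod measurableSet_Ioo)]
  refine lintegral_congr fun q => ?_
  by_cases hq : q ∈ polarCoord.target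
  · have hq0 : 0 < q.1 := hq.1
    rw [Set.indicator_of_mem hq, hsymm]
    by_cases hq1 : q.1 < 1
    · rw [Set.indicator_of_mem (Set.mk_mem_prod (Set.mem_Ioo.2 ⟨hq0, hq1⟩) hq.2),
        Set.indicator_of_mem (by simpa [abs_of_pos hq0] using hq1), Pi.mul_apply, smul_eq_mul,
        ← mul_assoc, ← ENNReal.ofReal_mul (by positivity)]
    · rw [Set.indicator_of_notMem (by simpa [abs_of_pos hq0] using hq1),
        Set.indicator_of_notMem fun h => hq1 h.1.2, smul_zero, mul_zero]
  · rw [Set.indicator_of_notMem hq, Set.indicator_of_notMem]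
    exact fun h => hq (Set.mk_mem_prod h.1.1 h.2)

theorem integral_diskMeasure_eq_circleAverage {g : ℂ → ℂ} (hg : Integrable g diskMeasure) :
    ∫ z, g z ∂diskMeasure = ∫ r in Set.Ioo (0 : ℝ) 1, (2 * r) • Real.circleAverage g 0 r := by
  have hdensity : Measurable fun q : ℝ × ℝ => ENNReal.ofReal (Real.pi⁻¹ * q.1) := by fun_prop
  rw [diskMeasure_eq_map_circleMap] at hg ⊢
  rw [integral_map measurable_circleMap_zero.aemeasurable hg.aestronglyMeasurable,
    integral_withDensity_eq_integral_toReal_smul hdensity (by simp)]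
  rw [integrable_map_measure hg.aestronglyMeasurable measurable_circleMap_zero.aemeasurable,
    integrable_withDensity_iff_integrable_smul' hdensity (by simp)] at hg
  rw [Measure.volume_eq_prod] at hg ⊢
  simp only [Function.comp_apply] at hg
  rw [setIntegral_prod _ hg]
  refine setIntegral_congr_fun measurableSet_Ioo fun r hr => ?_
  have hr0 : 0 < r := hr.1
  have hpi := Real.pi_pos
  have hangle : ∫ θ in Set.Ioo (-Real.pi) Real.pi, g (circleMap 0 r θ) =
      (2 * Real.pi) • Real.circleAverage g 0 r := by
    rw [Real.circleAverage_eq_integral_add (-Real.pi),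
      intervalIntegral.integral_comp_add_right fun θ => g (circleMap 0 r θ),
      smul_inv_smul₀ (by positivity), ← integral_Ioc_eq_integral_Ioo,
      ← intervalIntegral.integral_of_le (by linarith), zero_add]
    congr 1
    ring
  simp only [ENNReal.toReal_ofReal (show 0 ≤ Real.pi⁻¹ * r by positivity), integral_smul, hangle,
    smul_smul]
  congr 1
  field_simp

theorem quasihomogeneous_eq_zpow_mul (p : ℤ) (φ : ℝ → ℂ) {z : ℂ} (hz : z ≠ 0) :
    quasihomogeneous p φ z = (z / ‖z‖) ^ p * φ ‖z‖ := by
  have hpolar : z / ‖z‖ = Complex.exp (Complex.arg z * Complex.I) := by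
    rw [div_eq_iff (Complex.ofReal_ne_zero.2 (norm_ne_zero_iff.2 hz)), mul_comm]
    exact (Complex.norm_mul_exp_arg_mul_I z).symm
  rw [quasihomogeneous, hpolar, ← Complex.exp_int_mul]
  ring_nf

theorem pow_eq_quasihomogeneous (n : ℕ) {z : ℂ} (hz : z ≠ 0) :
    z ^ n = quasihomogeneous n (fun r => (r : ℂ) ^ (n : ℂ)) z := by
  have hnorm : (‖z‖ : ℂ) ≠ 0 := Complex.ofReal_ne_zero.2 (norm_ne_zero_iff.2 hz)
  rw [quasihomogeneous_eq_zpow_mul _ _ hz, zpow_natCast, Complex.cpow_natCast, ← mul_pow,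
    div_mul_cancel₀ _ hnorm]

theorem quasihomogeneous_mul (p q : ℤ) (φ ψ : ℝ → ℂ) :
    quasihomogeneous p φ * quasihomogeneous q ψ = quasihomogeneous (p + q) (φ * ψ) := by
  ext z
  simp only [quasihomogeneous, Pi.mul_apply, Int.cast_add, mul_add, add_mul, Complex.exp_add]
  ring

theorem exists_integral_quasihomogeneous_mul_conj {h : ℂ → ℂ} (hh : HarmonicOnNhd h (ball 0 1))
    (k : ℕ) : ∃ C : ℂ, ∀ ρ : ℝ → ℂ,
      Integrable (fun z => quasihomogeneous k ρ z * conj (h z)) diskMeasure →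
      ∫ z, quasihomogeneous k ρ z * conj (h z) ∂diskMeasure = C * radialMoment ρ (k + 1) := by
  obtain ⟨C, hC⟩ := exists_circleAverage_pow_mul_conj hh k
  refine ⟨2 * C, fun ρ hint => ?_⟩
  rw [integral_diskMeasure_eq_circleAverage hint, radialMoment, ← integral_const_mul]
  refine setIntegral_congr_fun measurableSet_Ioo fun r hr => ?_
  have hr0 : (r : ℂ) ≠ 0 := Complex.ofReal_ne_zero.2 hr.1.ne'
  have hsphere : Set.EqOn (fun z => quasihomogeneous k ρ z * conj (h z))
      (fun z => (ρ r / (r : ℂ) ^ k) • (z ^ k * conj (h z))) (sphere 0 |r|) := fun z hz => by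
    rw [mem_sphere_zero_iff_norm, abs_of_pos hr.1] at hz
    have hz0 : z ≠ 0 := norm_pos_iff.1 (hz ▸ hr.1)
    simp only [quasihomogeneous_eq_zpow_mul _ _ hz0, hz, zpow_natCast, div_pow, smul_eq_mul]
    ring
  rw [Real.circleAverage_congr_sphere hsphere, Real.circleAverage_fun_smul, hC r hr,
    Complex.real_smul, smul_eq_mul, Complex.cpow_add _ _ hr0, Complex.cpow_natCast,
    Complex.cpow_one, Complex.ofReal_mul, Complex.ofReal_ofNat, pow_mul']
  field_simp

theorem diskMeasure_ae_ne_zero : ∀ᵐ z ∂diskMeasure, z ≠ 0 :=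
  Measure.ae_smul_measure (ae_restrict_of_ae (Measure.ae_ne volume 0)) _

theorem memLp_pow_diskMeasure (n : ℕ) : MemLp (fun z : ℂ => z ^ n) 2 diskMeasure := by
  refine MemLp.of_bound (C := 1) (by fun_prop) ?_
  filter_upwards [diskMeasure_ae_mem] with z hz
  rw [norm_pow]
  exact pow_le_one₀ (norm_nonneg _) (mem_ball_zero_iff.1 hz).le

/-- The monomial `z ^ n` as an element of the harmonic Bergman space; Toeplitz operators with
quasihomogeneous symbols map these monomials to multiples of each other. -/
noncomputable def bergmanMonomial (n : ℕ) : harmonicBergman :=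
  ⟨(memLp_pow_diskMeasure n).toLp _, fun z => z ^ n,
    fun _ _ => (analyticAt_id.pow n).harmonicAt, (memLp_pow_diskMeasure n).coeFn_toLp⟩

theorem bergmanMonomial_coeFn (n : ℕ) :
    ⇑(bergmanMonomial n : Lp ℂ 2 diskMeasure) =ᵐ[diskMeasure]
      quasihomogeneous n fun r => (r : ℂ) ^ (n : ℂ) := by
  filter_upwards [(memLp_pow_diskMeasure n).coeFn_toLp, diskMeasure_ae_ne_zero] with z hz hz0
  exact hz.trans (pow_eq_quasihomogeneous n hz0)

theorem diskMeasure_ne_zero : diskMeasure ≠ 0 := by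
  intro h
  have hball : diskMeasure (ball 0 1) = 0 := by rw [h, Measure.coe_zero, Pi.zero_apply]
  rw [diskMeasure, Measure.smul_apply, Measure.restrict_apply_self, smul_eq_mul,
    mul_eq_zero] at hball
  exact hball.elim (ENNReal.ofReal_pos.2 (inv_pos.2 Real.pi_pos)).ne'
    (measure_ball_pos volume (0 : ℂ) one_pos).ne'

theorem bergmanMonomial_ne_zero (n : ℕ) : bergmanMonomial n ≠ 0 := by
  intro h
  have hzero : ⇑(bergmanMonomial n : Lp ℂ 2 diskMeasure) =ᵐ[diskMeasure] 0 := by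
    rw [h]
    exact Lp.coeFn_zero ℂ 2 diskMeasure
  have hfalse : ∀ᵐ _ ∂diskMeasure, False := by
    filter_upwards [hzero, (memLp_pow_diskMeasure n).coeFn_toLp, diskMeasure_ae_ne_zero]
      with z hz hpow hz0
    exact pow_ne_zero n hz0 (hpow.symm.trans hz)
  exact diskMeasure_ne_zero (by simpa using hfalse)

theorem exists_inner_eq_mul_radialMoment {u : Lp ℂ 2 diskMeasure} (hu : u ∈ harmonicBergman)
    (k : ℕ) : ∃ C : ℂ, ∀ (v : Lp ℂ 2 diskMeasure) (ρ : ℝ → ℂ),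
      v =ᵐ[diskMeasure] quasihomogeneous k ρ → inner ℂ u v = C * radialMoment ρ (k + 1) := by
  obtain ⟨h, hh, huh⟩ := hu
  obtain ⟨C, hC⟩ := exists_integral_quasihomogeneous_mul_conj hh k
  refine ⟨C, fun v ρ hv => ?_⟩
  have hinner : (fun z => inner ℂ (u z) (v z)) =ᵐ[diskMeasure]
      fun z => quasihomogeneous k ρ z * conj (h z) := by
    filter_upwards [huh, hv] with z huz hvz
    rw [huz, hvz, RCLike.inner_apply]
  rw [L2.inner_def, integral_congr_ae hinner,
    hC ρ ((L2.integrable_inner u v).congr hinner)]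

theorem orthogonalProjectionOnto_harmonicBergman {k : ℕ} {v : Lp ℂ 2 diskMeasure} {ρ : ℝ → ℂ}
    (hv : v =ᵐ[diskMeasure] quasihomogeneous k ρ) :
    harmonicBergman.orthogonalProjectionOnto v =
      ((2 * k + 2) * radialMoment ρ (k + 1)) • bergmanMonomial k := by
  refine Subtype.ext (Submodule.eq_starProjection_of_mem_orthogonal (SetLike.coe_mem _) ?_)
  rw [Submodule.mem_orthogonal]
  intro u hu
  obtain ⟨C, hC⟩ := exists_inner_eq_mul_radialMoment hu k
  have : (2 * k + 2 : ℂ) ≠ 0 := by exact_mod_cast (2 * k + 1).succ_ne_zero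
  have hpow : radialMoment (fun r => (r : ℂ) ^ (k : ℂ)) (k + 1) = 1 / (2 * k + 2) := by
    have hcpow := radialMoment_cpow_mul 1 (k + 1) k
    simp only [Pi.one_apply, mul_one] at hcpow
    rw [hcpow, radialMoment_one (by norm_cast; positivity)]
    ring
  rw [inner_sub_right, Submodule.coe_smul, inner_smul_right, hC v ρ hv,
    hC _ _ (bergmanMonomial_coeFn k), hpow]
  field_simp
  ring

theorem toeplitz_bergmanMonomial {n k : ℕ} {p : ℤ} (hk : (k : ℤ) = n + p) {φ : ℝ → ℂ}
    (hφ : MemLp φ ∞ (volume.restrict (Set.Ioo (0 : ℝ) 1))) :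
    toeplitz (quasihomogeneous p φ) (memLp_quasihomogeneous p hφ) (bergmanMonomial n) =
      ((2 * k + 2) * radialMoment φ (n + k + 1)) • bergmanMonomial k := by
  have hmul : ⇑((ContinuousLinearMap.mul ℂ ℂ).holderL diskMeasure ∞ 2 2
      ((memLp_quasihomogeneous p hφ).toLp _) (bergmanMonomial n)) =ᵐ[diskMeasure]
      quasihomogeneous k (fun r => (r : ℂ) ^ (n : ℂ) * φ r) := by
    rw [ContinuousLinearMap.holderL_apply_apply]
    filter_upwards [ContinuousLinearMap.coeFn_holder (r := 2) (ContinuousLinearMap.mul ℂ ℂ)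
      ((memLp_quasihomogeneous p hφ).toLp _) (bergmanMonomial n : Lp ℂ 2 diskMeasure),
      (memLp_quasihomogeneous p hφ).coeFn_toLp, bergmanMonomial_coeFn n] with z hz hφz hnz
    rw [hz, hφz, hnz, ContinuousLinearMap.mul_apply', mul_comm, hk]
    exact congrFun (quasihomogeneous_mul n p _ φ) z
  refine (orthogonalProjectionOnto_harmonicBergman hmul).trans ?_
  rw [radialMoment_cpow_mul, add_right_comm, add_comm (k : ℂ)]

theorem radialMoment_mul_eq_of_commute {n k l m : ℕ} {p s : ℤ} (hk : (k : ℤ) = n + p)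
    (hl : (l : ℤ) = n + s) (hm : (m : ℤ) = n + p + s) {φ ψ : ℝ → ℂ}
    (hφ : MemLp φ ∞ (volume.restrict (Set.Ioo (0 : ℝ) 1)))
    (hψ : MemLp ψ ∞ (volume.restrict (Set.Ioo (0 : ℝ) 1)))
    (hcomm : Commute (toeplitz (quasihomogeneous s ψ) (memLp_quasihomogeneous s hψ))
      (toeplitz (quasihomogeneous p φ) (memLp_quasihomogeneous p hφ))) :
    (k + 1) * radialMoment φ (n + k + 1) * radialMoment ψ (k + m + 1) =
      (l + 1) * radialMoment ψ (n + l + 1) * radialMoment φ (l + m + 1) := by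
  have happly := congrArg (fun T => T (bergmanMonomial n)) hcomm.eq
  simp only [mul_apply_eq_comp] at happly
  rw [toeplitz_bergmanMonomial hk hφ, toeplitz_bergmanMonomial hl hψ, map_smul, map_smul,
    toeplitz_bergmanMonomial (k := m) (by omega) hψ,
    toeplitz_bergmanMonomial (k := m) (by omega) hφ, smul_smul, smul_smul] at happly
  have hcoeff := smul_left_injective ℂ (bergmanMonomial_ne_zero m) happly
  have hm0 : (m + 1 : ℂ) ≠ 0 := Nat.cast_add_one_ne_zero m
  refine mul_left_cancel₀ (mul_ne_zero (by norm_num : (4 : ℂ) ≠ 0) hm0) ?_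
  linear_combination hcoeff

theorem ae_eq_zero_of_eqOn_radialMoment_add {φ : ℝ → ℂ} (hφ : IntegrableOn φ (Set.Ioo 0 1)) {a : ℝ}
    (ha : 0 ≤ a) (h : Set.EqOn (fun z => radialMoment φ (z + a)) 0 rightHalfPlane) :
    φ =ᵐ[volume.restrict (Set.Ioo (0 : ℝ) 1)] 0 :=
  ae_eq_zero_of_eqOn_radialMoment hφ
    (boundedHolomorphic.eqOn_zero_of_comp_add_const (radialMoment_mem_boundedHolomorphic hφ) ha h)

theorem exists_ae_eq_smul_of_radialMoment_div_periodic {ψ₁ ψ₂ : ℝ → ℂ}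
    (hψ₁ : IntegrableOn ψ₁ (Set.Ioo 0 1)) (hψ₂ : IntegrableOn ψ₂ (Set.Ioo 0 1))
    (hψ₂0 : ¬ ψ₂ =ᵐ[volume.restrict (Set.Ioo (0 : ℝ) 1)] 0) {b d : ℝ} (hb : 0 ≤ b) (hd : 0 < d)
    (h : ∀ z ∈ rightHalfPlane, radialMoment ψ₁ (z + d + b) * radialMoment ψ₂ (z + b) =
      radialMoment ψ₂ (z + d + b) * radialMoment ψ₁ (z + b)) :
    ∃ c : ℂ, ψ₁ =ᵐ[volume.restrict (Set.Ioo (0 : ℝ) 1)] c • ψ₂ := by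
  have hbre : 0 ≤ (b : ℂ).re := by simpa using hb
  obtain ⟨c, hc⟩ := boundedHolomorphic.exists_eqOn_smul_of_div_periodic
    (boundedHolomorphic.comp_add_const_mem (radialMoment_mem_boundedHolomorphic hψ₁) hbre)
    (boundedHolomorphic.comp_add_const_mem (radialMoment_mem_boundedHolomorphic hψ₂) hbre)
    (fun h0 => hψ₂0 (ae_eq_zero_of_eqOn_radialMoment_add hψ₂ hb h0)) hd h
  refine ⟨c, (sub_ae_eq_zero _ _).1
    (ae_eq_zero_of_eqOn_radialMoment_add (hψ₁.sub (hψ₂.smul c)) hb fun z hz => ?_)⟩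
  have hzb : 0 ≤ (z + b).re := (add_mem_rightHalfPlane hz hbre).le
  change radialMoment _ (z + b) = 0
  rw [radialMoment_sub hψ₁ (hψ₂.smul c) hzb, radialMoment_smul]
  exact sub_eq_zero.2 (hc hz)

section CommutingSymbols

variable {p s : ℤ} {φ ψ₁ ψ₂ : ℝ → ℂ}
  (hφ : MemLp φ ∞ (volume.restrict (Set.Ioo (0 : ℝ) 1)))
  (hψ₁ : MemLp ψ₁ ∞ (volume.restrict (Set.Ioo (0 : ℝ) 1)))
  (hψ₂ : MemLp ψ₂ ∞ (volume.restrict (Set.Ioo (0 : ℝ) 1)))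

theorem radialMoment_mul_sub_eq_zero_of_commute
    (hcomm₁ : Commute (toeplitz (quasihomogeneous s ψ₁) (memLp_quasihomogeneous s hψ₁))
      (toeplitz (quasihomogeneous p φ) (memLp_quasihomogeneous p hφ)))
    (hcomm₂ : Commute (toeplitz (quasihomogeneous s ψ₂) (memLp_quasihomogeneous s hψ₂))
      (toeplitz (quasihomogeneous p φ) (memLp_quasihomogeneous p hφ)))
    {n : ℕ} (hp : 0 ≤ n + p) (hs : 0 ≤ n + s) (hps : 0 ≤ n + p + s) :
    radialMoment φ (2 * n + p + 1) *
      (radialMoment ψ₁ (2 * (n + p) + s + 1) * radialMoment ψ₂ (2 * n + s + 1) -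
        radialMoment ψ₂ (2 * (n + p) + s + 1) * radialMoment ψ₁ (2 * n + s + 1)) = 0 := by
  obtain ⟨k, hk⟩ := Int.eq_ofNat_of_zero_le hp
  obtain ⟨l, hl⟩ := Int.eq_ofNat_of_zero_le hs
  obtain ⟨m, hm⟩ := Int.eq_ofNat_of_zero_le hps
  have hkC : (n + p : ℂ) = k := by exact_mod_cast hk
  have hlC : (n + s : ℂ) = l := by exact_mod_cast hl
  have hmC : (n + p + s : ℂ) = m := by exact_mod_cast hm
  rw [show (2 * n + p + 1 : ℂ) = n + k + 1 by rw [← hkC]; ring,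
    show (2 * (n + p) + s + 1 : ℂ) = k + m + 1 by rw [← hkC, ← hmC]; ring,
    show (2 * n + s + 1 : ℂ) = n + l + 1 by rw [← hlC]; ring]
  have h₁ := radialMoment_mul_eq_of_commute hk.symm hl.symm hm.symm hφ hψ₁ hcomm₁
  have h₂ := radialMoment_mul_eq_of_commute hk.symm hl.symm hm.symm hφ hψ₂ hcomm₂
  refine (mul_eq_zero.1 ?_).resolve_left (Nat.cast_add_one_ne_zero k)
  linear_combination radialMoment ψ₂ (n + l + 1) * h₁ - radialMoment ψ₁ (n + l + 1) * h₂

theorem eqOn_radialMoment_mul_radialMoment_of_commute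
    (hφ0 : ¬ φ =ᵐ[volume.restrict (Set.Ioo (0 : ℝ) 1)] 0)
    (hcomm₁ : Commute (toeplitz (quasihomogeneous s ψ₁) (memLp_quasihomogeneous s hψ₁))
      (toeplitz (quasihomogeneous p φ) (memLp_quasihomogeneous p hφ)))
    (hcomm₂ : Commute (toeplitz (quasihomogeneous s ψ₂) (memLp_quasihomogeneous s hψ₂))
      (toeplitz (quasihomogeneous p φ) (memLp_quasihomogeneous p hφ)))
    {N : ℕ} (hp : 0 ≤ N + p) (hs : 0 ≤ N + s) (hps : 0 ≤ N + p + s) :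
    Set.EqOn
      (fun z => radialMoment ψ₁ (z + (2 * (N + p) + s : ℝ)) * radialMoment ψ₂ (z + (2 * N + s : ℝ)))
      (fun z => radialMoment ψ₂ (z + (2 * (N + p) + s : ℝ)) * radialMoment ψ₁ (z + (2 * N + s : ℝ)))
      rightHalfPlane := by
  have hshift {a : ℝ} (ha : 0 ≤ a) {ψ : ℝ → ℂ}
      (hψ : MemLp ψ ∞ (volume.restrict (Set.Ioo (0 : ℝ) 1))) :
      (fun z => radialMoment ψ (z + a)) ∈ boundedHolomorphic :=
    boundedHolomorphic.comp_add_const_mem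
      (radialMoment_mem_boundedHolomorphic (hψ.integrable (by simp))) (by simpa using ha)
  have ha : 0 ≤ (2 * N + p : ℝ) := by exact_mod_cast (by omega : (0 : ℤ) ≤ 2 * N + p)
  have hb : 0 ≤ (2 * N + s : ℝ) := by exact_mod_cast (by omega : (0 : ℤ) ≤ 2 * N + s)
  have hc : 0 ≤ (2 * (N + p) + s : ℝ) := by
    exact_mod_cast (by omega : (0 : ℤ) ≤ 2 * (N + p) + s)
  have hA := hshift ha hφ
  have hD := sub_mem (mul_mem (hshift hc hψ₁) (hshift hb hψ₂))
    (mul_mem (hshift hc hψ₂) (hshift hb hψ₁))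
  have hAD := boundedHolomorphic.eqOn_zero_of_arithmetic_progression (mul_mem hA hD) one_pos two_pos
    fun j => by
      have hzero := radialMoment_mul_sub_eq_zero_of_commute hφ hψ₁ hψ₂ hcomm₁ hcomm₂
        (n := N + j) (by omega) (by omega) (by omega)
      rwa [
        show (2 * (N + j : ℕ) + p + 1 : ℂ) = (1 + 2 * j : ℝ) + (2 * N + p : ℝ) by push_cast; ring,
        show (2 * ((N + j : ℕ) + p) + s + 1 : ℂ) = (1 + 2 * j : ℝ) + (2 * (N + p) + s : ℝ) by
          push_cast; ring,
        show (2 * (N + j : ℕ) + s + 1 : ℂ) = (1 + 2 * j : ℝ) + (2 * N + s : ℝ) by push_cast; ring]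
        at hzero
  intro z hz
  rcases boundedHolomorphic.eqOn_zero_or_eqOn_zero hA hD hAD with hA0 | hD0
  · exact absurd (ae_eq_zero_of_eqOn_radialMoment_add (hφ.integrable (by simp)) ha hA0) hφ0
  · exact sub_eq_zero.1 (hD0 hz)

end CommutingSymbols

theorem theorem4_general {p s : ℤ} (hp : p ≠ 0) {φ ψ₁ ψ₂ : ℝ → ℂ}
    (hφ : MemLp φ ∞ (volume.restrict (Set.Ioo (0 : ℝ) 1)))
    (hφ0 : ¬ φ =ᵐ[volume.restrict (Set.Ioo (0 : ℝ) 1)] 0)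
    (hψ₁ : MemLp ψ₁ ∞ (volume.restrict (Set.Ioo (0 : ℝ) 1)))
    (hψ₂ : MemLp ψ₂ ∞ (volume.restrict (Set.Ioo (0 : ℝ) 1)))
    (hcomm₁ : Commute (toeplitz (quasihomogeneous s ψ₁) (memLp_quasihomogeneous s hψ₁))
      (toeplitz (quasihomogeneous p φ) (memLp_quasihomogeneous p hφ)))
    (hcomm₂ : Commute (toeplitz (quasihomogeneous s ψ₂) (memLp_quasihomogeneous s hψ₂))
      (toeplitz (quasihomogeneous p φ) (memLp_quasihomogeneous p hφ)))
    (hψ₂0 : ¬ ψ₂ =ᵐ[volume.restrict (Set.Ioo (0 : ℝ) 1)] 0) :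
    ∃ c : ℂ, ψ₁ =ᵐ[volume.restrict (Set.Ioo (0 : ℝ) 1)] c • ψ₂ := by
  obtain ⟨N, hN⟩ : ∃ N : ℕ, |p| + |s| = N := Int.eq_ofNat_of_zero_le (by positivity)
  have hpN : 0 ≤ N + p := by grind
  have hsN : 0 ≤ N + s := by grind
  have hpsN : 0 ≤ N + p + s := by grind
  have hb : 0 ≤ (2 * N + s : ℝ) := by exact_mod_cast (by omega : (0 : ℤ) ≤ 2 * N + s)
  have hc : 0 ≤ (2 * (N + p) + s : ℝ) := by
    exact_mod_cast (by omega : (0 : ℤ) ≤ 2 * (N + p) + s)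
  have hcross := eqOn_radialMoment_mul_radialMoment_of_commute hφ hψ₁ hψ₂ hφ0 hcomm₁ hcomm₂
    hpN hsN hpsN
  have hmain {b d : ℝ} := exists_ae_eq_smul_of_radialMoment_div_periodic (b := b) (d := d)
    (hψ₁.integrable (by simp)) (hψ₂.integrable (by simp)) hψ₂0
  rcases hp.lt_or_gt with hneg | hpos
  · have hd : 0 < (-(2 * p) : ℝ) := by exact_mod_cast (by omega : 0 < -(2 * p))
    refine hmain hc hd fun z hz => ?_
    rw [add_assoc, ← Complex.ofReal_add,
      show (-(2 * p) + (2 * (N + p) + s) : ℝ) = 2 * N + s by ring]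
    linear_combination -(hcross hz)
  · have hd : 0 < (2 * p : ℝ) := by exact_mod_cast (by omega : 0 < 2 * p)
    refine hmain hb hd fun z hz => ?_
    rw [add_assoc, ← Complex.ofReal_add,
      show (2 * p + (2 * N + s) : ℝ) = 2 * (N + p) + s by ring]
    exact hcross hz

/-- For positive integers `p`, `s` and a non-constant bounded radial `φ`, the bounded radial functions
`ψ` for which `T_{e^{isθ}ψ}` commutes with `T_{e^{ipθ}φ}` are multiples of each other. Bounded radial
functions are elements of `L^∞(0, 1)`, so that equality and constancy are meant almost everywhere. -/
theorem theorem4 (p s : ℕ) (hp : 0 < p) (hs : 0 < s)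
    (φ : ℝ → ℂ) (hφ : MemLp φ ∞ (volume.restrict (Set.Ioo (0 : ℝ) 1)))
    (hφc : ¬ ∃ c : ℂ, φ =ᵐ[volume.restrict (Set.Ioo (0 : ℝ) 1)] fun _ => c)
    (ψ₁ ψ₂ : ℝ → ℂ)
    (hψ₁ : MemLp ψ₁ ∞ (volume.restrict (Set.Ioo (0 : ℝ) 1)))
    (hψ₂ : MemLp ψ₂ ∞ (volume.restrict (Set.Ioo (0 : ℝ) 1)))
    (hcomm₁ : Commute (toeplitz (quasihomogeneous s ψ₁) (memLp_quasihomogeneous s hψ₁))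
      (toeplitz (quasihomogeneous p φ) (memLp_quasihomogeneous p hφ)))
    (hcomm₂ : Commute (toeplitz (quasihomogeneous s ψ₂) (memLp_quasihomogeneous s hψ₂))
      (toeplitz (quasihomogeneous p φ) (memLp_quasihomogeneous p hφ)))
    (hψ₂0 : ¬ ψ₂ =ᵐ[volume.restrict (Set.Ioo (0 : ℝ) 1)] 0) :
    ∃ c : ℂ, ψ₁ =ᵐ[volume.restrict (Set.Ioo (0 : ℝ) 1)] fun r => c * ψ₂ r :=
  theorem4_general (Int.natCast_ne_zero.2 hp.ne') hφ (fun h => hφc ⟨0, h⟩) hψ₁ hψ₂ hcomm₁ hcomm₂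
    hψ₂0
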